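/- Let $K$ be an algebraically closed field and let $A$ be a Nakayama algebra over $K$, i.e. a finite dimensional $K$-algebra such that every indecomposable projective and every indecomposable injective (left) $A$-module is uniserial. Then there is a bijection between - the universal localisations of $A$ up to epiclasses, and - the isomorphism classes of orthogonal collections of finitely generated $A$-modules. Here a \emph{universal localisation} of $A$ is a homomorphism of unital rings $f\colon A\to A_\Sigma$ for which there is a set $\Sigma$ of maps between finitely generated projective left $A$-modules such that $A_\Sigma\otimes_A\sigma$ is an isomorphism for all $\sigma\in\Sigma$, and every ring homomorphism $g\colon A\to B$ such that $B\otimes_A\sigma$ is an isomorphism for all $\sigma\in\Sigma$ factors uniquely through $f$ (the zero ring is allowed). Two universal localisations $f\colon A\to B$ and $g\colon A\to C$ lie in the same \emph{epiclass} if there is a ring isomorphism $h\colon B\to C$ with $g=hf$. An \emph{orthogonal collection} is a finite (possibly empty) set $\{X_1,\dots,X_s\}$ of finitely generated indecomposable left $A$-modules with $\mathrm{End}_A(X_i)\cong K$ for all $i$ and $\mathrm{Hom}_A(X_i,X_j)=0$ for all $i\neq j$; two orthogonal collections are isomorphic if there is a bijection between them that sends each module to an isomorphic one. -/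

import Mathlib

open scoped TensorProduct

universe u v w

section Modules

variable (A : Type u) [Ring A] (M : Type v) [AddCommGroup M] [Module A M]

/-- A nonzero module that is not the direct sum of two nonzero submodules. -/
def IsIndecomposableModule : Prop :=
  Nontrivial M ∧ ∀ N N' : Submodule A M, IsCompl N N' → N = ⊥ ∨ N' = ⊥

/-- A module whose submodules form a chain. -/
def IsUniserialModule : Prop :=
  ∀ N N' : Submodule A M, N ≤ N' ∨ N' ≤ N

end Modules

/-- The Nakayama condition on a finite dimensional algebra `A` (finite dimensionality is a
separate assumption): every finitely generated indecomposable left module which is projective or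
injective is uniserial. -/
structure IsNakayama (A : Type v) [Ring A] : Prop where
  projective_uniserial : ∀ (P : Type v) [AddCommGroup P] [Module A P], Module.Finite A P →
    Module.Projective A P → IsIndecomposableModule A P → IsUniserialModule A P
  injective_uniserial : ∀ (I : Type v) [AddCommGroup I] [Module A I], Module.Finite A I →
    Module.Injective A I → IsIndecomposableModule A I → IsUniserialModule A I

section BaseChange

variable {A : Type u} {B : Type v} [Ring A] [Ring B] (f : A →+* B)

/-- The relations `b f(a) ⊗ m = b ⊗ a m` in `B ⊗_ℤ M`. -/
def baseChangeRel (M : Type w) [AddCommGroup M] [Module A M] : Submodule B (B ⊗[ℤ] M) :=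
  Submodule.span B
    {t | ∃ (b : B) (a : A) (m : M), t = (b * f a) ⊗ₜ[ℤ] m - b ⊗ₜ[ℤ] (a • m)}

/-- The left `B`-module `B ⊗_A M`, where `B` is a right `A`-module through `f : A → B`. The rings
need not be commutative, so it is the quotient of `B ⊗_ℤ M` by the `A`-balancing relations. -/
abbrev BaseChange (M : Type w) [AddCommGroup M] [Module A M] : Type (max v w) :=
  (B ⊗[ℤ] M) ⧸ baseChangeRel f M

/-- The `B`-linear map `B ⊗_A σ`. -/
def baseChangeMap {M N : Type w} [AddCommGroup M] [Module A M] [AddCommGroup N] [Module A N]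
    (σ : M →ₗ[A] N) : BaseChange f M →ₗ[B] BaseChange f N :=
  Submodule.mapQ (baseChangeRel f M) (baseChangeRel f N)
    (TensorProduct.AlgebraTensorModule.map (LinearMap.id : B →ₗ[B] B)
      σ.toAddMonoidHom.toIntLinearMap)
    (by
      rw [baseChangeRel, Submodule.span_le]
      rintro _ ⟨b, a, m, rfl⟩
      refine Submodule.subset_span ⟨b, a, σ m, ?_⟩
      simp)

end BaseChange

section Localisation

/-- A homomorphism between finitely generated projective left `A`-modules. -/
structure FGProjectiveMap (A : Type v) [Ring A] where
  source : ModuleCat.{v} A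
  target : ModuleCat.{v} A
  source_finite : Module.Finite A source
  source_projective : Module.Projective A source
  target_finite : Module.Finite A target
  target_projective : Module.Projective A target
  map : source →ₗ[A] target

variable {A : Type v} [Ring A]

/-- `B ⊗_A σ` is an isomorphism for all `σ` in `S`. -/
def InvertsMaps (S : Set (FGProjectiveMap A)) {B : Type v} [Ring B] (f : A →+* B) : Prop :=
  ∀ σ ∈ S, Function.Bijective (baseChangeMap f σ.map)

/-- `f : A → B` is the universal localisation of `A` at `S`. -/
def IsUniversalLocalisationAt (S : Set (FGProjectiveMap A)) {B : Type v} [Ring B]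
    (f : A →+* B) : Prop :=
  InvertsMaps S f ∧
    ∀ (C : Type v) [Ring C] (g : A →+* C), InvertsMaps S g →
      ∃! h : B →+* C, h.comp f = g

variable (A)

/-- A universal localisation `A → A_S` for some set `S` of maps between finitely generated
projective modules. -/
structure UniversalLocalisation where
  ring : Type v
  [instRing : Ring ring]
  hom : A →+* ring
  isLocalisation : ∃ S : Set (FGProjectiveMap A), IsUniversalLocalisationAt S hom

attribute [instance] UniversalLocalisation.instRing

/-- Two universal localisations `f : A → B` and `g : A → C` lie in the same epiclass if `g = h f`
for a ring isomorphism `h : B → C`. -/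
instance UniversalLocalisation.epiclassSetoid : Setoid (UniversalLocalisation A) where
  r L L' := ∃ h : L.ring ≃+* L'.ring, (h : L.ring →+* L'.ring).comp L.hom = L'.hom
  iseqv :=
    { refl := fun L => ⟨RingEquiv.refl _, by ext; simp⟩
      symm := by
        rintro L L' ⟨h, hh⟩
        refine ⟨h.symm, ?_⟩
        rw [← hh]
        ext
        simp
      trans := by
        rintro L L' L'' ⟨h, hh⟩ ⟨k, hk⟩
        refine ⟨h.trans k, ?_⟩
        rw [← hk, ← hh]
        ext
        simp }

/-- Universal localisations of `A` up to epiclasses. -/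
abbrev UniLoc : Type (v + 1) := Quotient (UniversalLocalisation.epiclassSetoid A)

end Localisation

section Orthogonal

variable (K : Type u) [Field K] (A : Type v) [Ring A] [Algebra K A]

/-- `End_A(X) ≅ K` as `K`-algebras, where `K` acts on `X` through `K → A`. -/
def HasTrivialEndomorphisms (X : Type v) [AddCommGroup X] [Module A X] : Prop :=
  letI : Module K X := Module.compHom X (algebraMap K A)
  haveI : IsScalarTower K A X := IsScalarTower.of_algebraMap_smul fun _ _ => rfl
  Nonempty (Module.End A X ≃ₐ[K] K)

/-- A finite set of pairwise `Hom`-orthogonal, finitely generated indecomposable left `A`-modules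
with endomorphism algebra `K`. -/
structure OrthogonalCollection where
  carrier : Set (ModuleCat.{v} A)
  finite : carrier.Finite
  finitelyGenerated : ∀ X ∈ carrier, Module.Finite A X
  indecomposable : ∀ X ∈ carrier, IsIndecomposableModule A X
  trivialEndomorphisms : ∀ X ∈ carrier, HasTrivialEndomorphisms K A X
  orthogonal : ∀ X ∈ carrier, ∀ Y ∈ carrier, X ≠ Y → ∀ φ : X →ₗ[A] Y, φ = 0

/-- Two collections are isomorphic if there is a bijection between them which sends each module to
an isomorphic one. -/
instance OrthogonalCollection.isoSetoid : Setoid (OrthogonalCollection K A) where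
  r S T := ∃ e : S.carrier ≃ T.carrier,
    ∀ X : S.carrier, Nonempty ((X : ModuleCat.{v} A) ≃ₗ[A] (e X : ModuleCat.{v} A))
  iseqv :=
    { refl := fun S => ⟨Equiv.refl _, fun X => ⟨LinearEquiv.refl A _⟩⟩
      symm := by
        rintro S T ⟨e, he⟩
        refine ⟨e.symm, fun Y => ?_⟩
        obtain ⟨l⟩ := he (e.symm Y)
        rw [e.apply_symm_apply] at l
        exact ⟨l.symm⟩
      trans := by
        rintro S T U ⟨e, he⟩ ⟨d, hd⟩
        exact ⟨e.trans d, fun X => ⟨(he X).some.trans (hd (e X)).some⟩⟩ }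

/-- Isomorphism classes of orthogonal collections of `A`-modules. -/
abbrev OrthogonalCollectionClasses : Type (v + 1) :=
  Quotient (OrthogonalCollection.isoSetoid K A)

end Orthogonal

/-! Let S be a set of maps between finitely generated projectives. The S-local modules are closed
under kernels, extensions and quotients by local submodules. So the finitely generated ones form an
abelian category, and its simple objects obey Schur's lemma. The bijection sends the localisation at
S to these simple objects.

A ring map A → C inverts S exactly when C is S-local as a left A-module (`InvertsMaps.isLocal`,
`InvertsMaps.of_isLocal`), so the localisation depends only on the class of S-local modules.
Conversely, the localisation determines the finitely generated local modules: if X is local, then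
End_K(X), a power of X, is local, so A → End_K(X) inverts S and X becomes a module over the
localisation (`IsUniversalLocalisationAt.isLocal_of_ringHom`).

The Nakayama condition is used through three facts. Elements fixed by the same primitive idempotent
have comparable annihilators, so of two cyclic modules with such generators one maps nontrivially to
the other; hence there are only finitely many simple local modules. By duality, eA is uniserial as a
right module. Finally, every finitely generated submodule of any module lies in a finitely generated
direct summand (`exists_fg_retract`), so locality of a large module such as C can be tested on
finitely generated local modules. Those are iterated extensions of simple local ones
(`IsLocal.of_forall_isSimpleLocal`), and therefore the simple ones determine the localisation.

For surjectivity, let T be an orthogonal collection and invert all maps Ae → Af, with e and f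
idempotent, for which every member of T is local. There must be enough such maps to exclude proper
local submodules of members and further simple local modules. The criterion
`OrthogonalCollection.mem_idempotentMaps` supplies them: applied to a socle element it gives
simplicity of the members, and applied to a shortest member with eX ≠ 0 it shows that every simple
local module is a member up to isomorphism. -/

/-! ### Modules local with respect to a homomorphism -/

section Local

/-- `M` is local with respect to `σ : P → Q` if every map `P → M` extends uniquely along `σ`. -/
def IsLocalFor {A : Type*} [Ring A] {P Q : Type*} [AddCommGroup P] [Module A P] [AddCommGroup Q]
    [Module A Q] (σ : P →ₗ[A] Q) (M : Type*) [AddCommGroup M] [Module A M] : Prop :=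
  Function.Bijective fun φ : Q →ₗ[A] M => φ ∘ₗ σ

namespace IsLocalFor

variable {A : Type*} [Ring A] {P Q : Type*} [AddCommGroup P] [Module A P] [AddCommGroup Q]
  [Module A Q] {σ : P →ₗ[A] Q} {M N : Type*} [AddCommGroup M] [Module A M] [AddCommGroup N]
  [Module A N]

theorem ext (h : IsLocalFor σ M) {φ ψ : Q →ₗ[A] M} (e : φ ∘ₗ σ = ψ ∘ₗ σ) : φ = ψ := h.1 e

theorem eq_zero (h : IsLocalFor σ M) {φ : Q →ₗ[A] M} (e : φ ∘ₗ σ = 0) : φ = 0 :=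
  h.ext (by rw [e, LinearMap.zero_comp])

theorem exists_extension (h : IsLocalFor σ M) (θ : P →ₗ[A] M) : ∃ φ : Q →ₗ[A] M, φ ∘ₗ σ = θ :=
  h.2 θ

theorem of_retract (h : IsLocalFor σ M) (i : N →ₗ[A] M) (r : M →ₗ[A] N)
    (hri : r ∘ₗ i = LinearMap.id) : IsLocalFor σ N := by
  refine ⟨fun φ ψ e => ?_, fun θ => ?_⟩
  · have : i ∘ₗ φ = i ∘ₗ ψ := h.ext (by
      simp only [LinearMap.comp_assoc]; exact congrArg (i ∘ₗ ·) e)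
    have := congrArg (r ∘ₗ ·) this
    simpa only [← LinearMap.comp_assoc, hri, LinearMap.id_comp] using this
  · obtain ⟨φ, hφ⟩ := h.exists_extension (i ∘ₗ θ)
    refine ⟨r ∘ₗ φ, ?_⟩
    simp only [LinearMap.comp_assoc, hφ]
    rw [← LinearMap.comp_assoc, hri, LinearMap.id_comp]

theorem of_equiv (h : IsLocalFor σ M) (e : M ≃ₗ[A] N) : IsLocalFor σ N :=
  h.of_retract e.symm.toLinearMap e.toLinearMap (by ext; simp)

theorem pi {ι : Type*} {M : ι → Type*} [∀ i, AddCommGroup (M i)] [∀ i, Module A (M i)]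
    (h : ∀ i, IsLocalFor σ (M i)) : IsLocalFor σ (∀ i, M i) := by
  refine ⟨fun φ ψ e => ?_, fun θ => ?_⟩
  · ext x i
    have : LinearMap.proj i ∘ₗ φ = LinearMap.proj i ∘ₗ ψ := (h i).ext (by
      simp only [LinearMap.comp_assoc]; exact congrArg (LinearMap.proj i ∘ₗ ·) e)
    exact LinearMap.congr_fun this x
  · choose φ hφ using fun i => (h i).exists_extension (LinearMap.proj i ∘ₗ θ)
    refine ⟨LinearMap.pi φ, ?_⟩
    ext x i
    exact LinearMap.congr_fun (hφ i) x

theorem ker (hM : IsLocalFor σ M) (hN : IsLocalFor σ N) (φ : M →ₗ[A] N) :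
    IsLocalFor σ (LinearMap.ker φ) := by
  refine ⟨fun ψ χ e => ?_, fun θ => ?_⟩
  · have : (LinearMap.ker φ).subtype ∘ₗ ψ = (LinearMap.ker φ).subtype ∘ₗ χ := hM.ext (by
      simp only [LinearMap.comp_assoc]; exact congrArg ((LinearMap.ker φ).subtype ∘ₗ ·) e)
    ext x
    exact LinearMap.congr_fun this x
  · obtain ⟨ψ, hψ⟩ := hM.exists_extension ((LinearMap.ker φ).subtype ∘ₗ θ)
    have h0 : φ ∘ₗ ψ = 0 := hN.eq_zero (by
      rw [LinearMap.comp_assoc, hψ]; ext x; exact (θ x).2)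
    refine ⟨ψ.codRestrict _ fun x => LinearMap.congr_fun h0 x, ?_⟩
    ext x
    exact LinearMap.congr_fun hψ x

/-- A five lemma argument. Projectivity of Q lifts Q → M/L to M; the resulting error on P takes
values in L and is corrected there. -/
theorem of_extension [Module.Projective A Q] {L : Submodule A M} (hL : IsLocalFor σ L)
    (hQ : IsLocalFor σ (M ⧸ L)) : IsLocalFor σ M := by
  refine ⟨fun φ ψ e => ?_, fun θ => ?_⟩
  · have e' : (φ - ψ) ∘ₗ σ = 0 := by
      rw [LinearMap.sub_comp, sub_eq_zero]; exact e
    have h0 : L.mkQ ∘ₗ (φ - ψ) = 0 := hQ.eq_zero (by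
      rw [LinearMap.comp_assoc, e', LinearMap.comp_zero])
    have h1 : ∀ x, (φ - ψ) x ∈ L := fun x => by
      rw [← Submodule.Quotient.mk_eq_zero]
      exact LinearMap.congr_fun h0 x
    have h2 : (φ - ψ).codRestrict L h1 = 0 := hL.eq_zero (by
      ext x; simpa using LinearMap.congr_fun e' x)
    rw [← sub_eq_zero]
    ext x
    exact congrArg Subtype.val (LinearMap.congr_fun h2 x)
  · obtain ⟨ψ, hψ⟩ := hQ.exists_extension (L.mkQ ∘ₗ θ)
    obtain ⟨ψ', hψ'⟩ := Module.projective_lifting_property L.mkQ ψ L.mkQ_surjective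
    have h1 : ∀ x, (θ - ψ' ∘ₗ σ) x ∈ L := fun x => by
      have h2 := LinearMap.congr_fun hψ x
      rw [← hψ'] at h2
      rw [← Submodule.Quotient.mk_eq_zero]
      simp only [LinearMap.sub_apply, Submodule.Quotient.mk_sub, sub_eq_zero]
      exact h2.symm
    obtain ⟨χ, hχ⟩ := hL.exists_extension ((θ - ψ' ∘ₗ σ).codRestrict L h1)
    refine ⟨ψ' + L.subtype ∘ₗ χ, ?_⟩
    ext x
    have h3 := congrArg Subtype.val (LinearMap.congr_fun hχ x)
    simp only [LinearMap.comp_apply, LinearMap.codRestrict_apply, LinearMap.sub_apply] at h3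
    simp only [LinearMap.comp_apply, LinearMap.add_apply, Submodule.subtype_apply, h3]
    abel

/-- For uniqueness, lift a map Q → M/L that vanishes on the image of σ to χ : Q → M. Then χσ has
values in L, extends to a map Q → L, and by uniqueness for M this extension is χ. Existence lifts P
→ M/L to M, which needs P projective. -/
theorem quotient [Module.Projective A P] [Module.Projective A Q] {L : Submodule A M}
    (hL : IsLocalFor σ L) (hM : IsLocalFor σ M) : IsLocalFor σ (M ⧸ L) := by
  refine ⟨fun φ ψ e => ?_, fun θ => ?_⟩
  · have e' : (φ - ψ) ∘ₗ σ = 0 := by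
      rw [LinearMap.sub_comp, sub_eq_zero]; exact e
    obtain ⟨χ, hχ⟩ := Module.projective_lifting_property L.mkQ (φ - ψ) L.mkQ_surjective
    have h1 : ∀ x, (χ ∘ₗ σ) x ∈ L := fun x => by
      rw [← Submodule.Quotient.mk_eq_zero]
      have h2 := LinearMap.congr_fun e' x
      rw [← hχ] at h2
      exact h2
    obtain ⟨ξ, hξ⟩ := hL.exists_extension ((χ ∘ₗ σ).codRestrict L h1)
    have h3 : χ = L.subtype ∘ₗ ξ := hM.ext (by
      rw [LinearMap.comp_assoc, hξ]; ext x; rfl)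
    rw [← sub_eq_zero, ← hχ, h3]
    ext x
    simp
  · obtain ⟨θ', hθ'⟩ := Module.projective_lifting_property L.mkQ θ L.mkQ_surjective
    obtain ⟨φ, hφ⟩ := hM.exists_extension θ'
    refine ⟨L.mkQ ∘ₗ φ, ?_⟩
    simp only [LinearMap.comp_assoc, hφ, hθ']

end IsLocalFor

variable {A : Type v} [Ring A]

/-- `M` is local with respect to all maps in `S`. -/
def IsLocal (S : Set (FGProjectiveMap A)) (M : Type*) [AddCommGroup M] [Module A M] : Prop :=
  ∀ σ ∈ S, IsLocalFor σ.map M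

namespace IsLocal

variable {S : Set (FGProjectiveMap A)} {M N : Type*} [AddCommGroup M] [Module A M]
  [AddCommGroup N] [Module A N]

theorem of_retract (h : IsLocal S M) (i : N →ₗ[A] M) (r : M →ₗ[A] N)
    (hri : r ∘ₗ i = LinearMap.id) : IsLocal S N := fun σ hσ => (h σ hσ).of_retract i r hri

theorem of_equiv (h : IsLocal S M) (e : M ≃ₗ[A] N) : IsLocal S N :=
  fun σ hσ => (h σ hσ).of_equiv e

theorem pi {ι : Type*} (h : IsLocal S M) : IsLocal S (ι → M) :=
  fun σ hσ => IsLocalFor.pi fun _ => h σ hσ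

theorem ker (hM : IsLocal S M) (hN : IsLocal S N) (φ : M →ₗ[A] N) :
    IsLocal S (LinearMap.ker φ) := fun σ hσ => (hM σ hσ).ker (hN σ hσ) φ

theorem of_extension {L : Submodule A M} (hL : IsLocal S L) (hQ : IsLocal S (M ⧸ L)) :
    IsLocal S M := fun σ hσ =>
  have := σ.target_projective
  (hL σ hσ).of_extension (hQ σ hσ)

theorem quotient {L : Submodule A M} (hL : IsLocal S L) (hM : IsLocal S M) :
    IsLocal S (M ⧸ L) := fun σ hσ =>
  have := σ.target_projective
  have := σ.source_projective
  (hL σ hσ).quotient (hM σ hσ)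

theorem range (hM : IsLocal S M) (hN : IsLocal S N) (φ : M →ₗ[A] N) :
    IsLocal S (LinearMap.range φ) :=
  ((hM.ker hN φ).quotient hM).of_equiv φ.quotKerEquivRange

theorem of_isCompl (hM : IsLocal S M) {L L' : Submodule A M} (h : IsCompl L L') : IsLocal S L :=
  hM.of_retract L.subtype (Submodule.projectionOnto L L' h) (by
    ext x; simp)

end IsLocal

end Local

/-! ### Inverting maps and locality -/

section BaseChangeLocal

variable {A : Type v} {C : Type v} [Ring A] [Ring C] (f : A →+* C)

/-- The canonical map `M → C ⊗_A M`. -/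
def baseChangeUnit (M : Type w) [AddCommGroup M] [Module A M] : M →+ BaseChange f M :=
  (baseChangeRel f M).mkQ.toAddMonoidHom.comp
    (TensorProduct.mk ℤ C M 1).toAddMonoidHom

variable {f} {M N : Type w} [AddCommGroup M] [Module A M] [AddCommGroup N] [Module A N]

theorem baseChangeUnit_apply (m : M) :
    baseChangeUnit f M m = (baseChangeRel f M).mkQ ((1 : C) ⊗ₜ[ℤ] m) := rfl

theorem baseChangeUnit_smul (a : A) (m : M) :
    baseChangeUnit f M (a • m) = f a • baseChangeUnit f M m := by
  rw [baseChangeUnit_apply, baseChangeUnit_apply, ← map_smul, eq_comm, ← sub_eq_zero, ← map_sub]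
  refine (Submodule.Quotient.mk_eq_zero _).2 (Submodule.subset_span ⟨1, a, m, ?_⟩)
  rw [TensorProduct.smul_tmul', smul_eq_mul, mul_one, one_mul]

theorem baseChangeMap_unit (σ : M →ₗ[A] N) (m : M) :
    baseChangeMap f σ (baseChangeUnit f M m) = baseChangeUnit f N (σ m) := by
  simp [baseChangeUnit_apply, baseChangeMap]

theorem baseChange_hom_ext {X : Type*} [AddCommGroup X] [Module C X]
    {φ ψ : BaseChange f M →ₗ[C] X}
    (h : ∀ m, φ (baseChangeUnit f M m) = ψ (baseChangeUnit f M m)) : φ = ψ := by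
  refine Submodule.linearMap_qext _ (TensorProduct.AlgebraTensorModule.ext fun c m => ?_)
  have : c ⊗ₜ[ℤ] m = c • ((1 : C) ⊗ₜ[ℤ] m) := by
    rw [TensorProduct.smul_tmul', smul_eq_mul, mul_one]
  rw [this, map_smul, map_smul]
  exact congrArg (c • ·) (h m)

/-- A `C`-linear map as an `A`-linear map, where `A` acts through `f : A → C`. -/
def LinearMap.restrictAlong {X Y : Type*} [AddCommGroup X] [Module A X] [Module C X]
    [AddCommGroup Y] [Module A Y] [Module C Y] (hX : ∀ (a : A) (x : X), a • x = f a • x)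
    (hY : ∀ (a : A) (y : Y), a • y = f a • y) (φ : X →ₗ[C] Y) : X →ₗ[A] Y where
  toFun := φ
  map_add' := map_add φ
  map_smul' a x := by rw [hX, hY, map_smul, RingHom.id_apply]

section Lift

variable {X : Type*} [AddCommGroup X] [Module A X] [Module C X]
  (hX : ∀ (a : A) (x : X), a • x = f a • x)
include hX

theorem exists_baseChangeLift (φ : M →ₗ[A] X) :
    ∃ ψ : BaseChange f M →ₗ[C] X, ∀ m, ψ (baseChangeUnit f M m) = φ m := by
  let t : C ⊗[ℤ] M →ₗ[C] X := TensorProduct.AlgebraTensorModule.lift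
    (LinearMap.toSpanSingleton C (M →ₗ[ℤ] X) φ.toAddMonoidHom.toIntLinearMap)
  have ht : ∀ c m, t (c ⊗ₜ m) = c • φ m := fun c m => by simp [t]
  refine ⟨Submodule.liftQ _ t ?_, fun m => ?_⟩
  · rw [baseChangeRel, Submodule.span_le]
    rintro _ ⟨b, a, m, rfl⟩
    simp only [SetLike.mem_coe, LinearMap.mem_ker, map_sub, ht, map_smul, hX, mul_smul, sub_self]
  · rw [baseChangeUnit_apply]
    simp [ht]

theorem IsLocalFor.of_baseChangeMap_bijective {σ : M →ₗ[A] N}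
    (h : Function.Bijective (baseChangeMap f σ)) : IsLocalFor σ X := by
  let e := LinearEquiv.ofBijective _ h
  refine ⟨fun φ ψ hφψ => ?_, fun θ => ?_⟩
  · obtain ⟨φ', hφ'⟩ := exists_baseChangeLift hX φ
    obtain ⟨ψ', hψ'⟩ := exists_baseChangeLift hX ψ
    have h1 : φ' ∘ₗ baseChangeMap f σ = ψ' ∘ₗ baseChangeMap f σ := baseChange_hom_ext fun m => by
      simp only [LinearMap.comp_apply, baseChangeMap_unit, hφ', hψ']
      exact LinearMap.congr_fun hφψ m
    have h2 : φ' = ψ' := by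
      refine LinearMap.ext fun x => ?_
      obtain ⟨y, rfl⟩ := h.2 x
      exact LinearMap.congr_fun h1 y
    ext n
    rw [← hφ', ← hψ', h2]
  · obtain ⟨θ', hθ'⟩ := exists_baseChangeLift hX θ
    refine ⟨{ toFun := fun n => θ' (e.symm (baseChangeUnit f N n)), map_add' := by simp,
              map_smul' := fun a n => by
                rw [baseChangeUnit_smul, map_smul, map_smul, RingHom.id_apply, hX] }, ?_⟩
    ext m
    have : e (baseChangeUnit f M m) = baseChangeUnit f N (σ m) := baseChangeMap_unit σ m
    simp [← this, hθ']

end Lift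

/-- A splitting of Aⁿ → M makes C ⊗ M a retract of Cⁿ, and locality passes to powers and retracts.
-/
theorem baseChange_isLocal [Module A C] (hC : ∀ (a : A) (x : C), a • x = f a * x)
    {S : Set (FGProjectiveMap A)} (hS : IsLocal S C) [Module.Finite A M] [Module.Projective A M]
    [Module A (BaseChange f M)] (hM : ∀ (a : A) (x : BaseChange f M), a • x = f a • x) :
    IsLocal S (BaseChange f M) := by
  obtain ⟨n, p, i, -, -, hpi⟩ := Module.Finite.exists_comp_eq_id_of_projective A M
  have hfn : ∀ (a : A) (x : Fin n → C), a • x = f a • x := fun a x => by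
    ext k; exact hC a (x k)
  let fC : A →ₗ[A] C := { toFun := f, map_add' := map_add f, map_smul' := fun a b => by
                            rw [smul_eq_mul, map_mul, RingHom.id_apply, hC] }
  obtain ⟨ι, hι⟩ := exists_baseChangeLift hfn
    ((LinearMap.pi fun k => fC ∘ₗ LinearMap.proj k) ∘ₗ i : M →ₗ[A] Fin n → C)
  let ρ : (Fin n → C) →ₗ[C] BaseChange f M :=
    Fintype.linearCombination C fun k => baseChangeUnit f M (p (Pi.single k 1))
  have hρι : ρ ∘ₗ ι = LinearMap.id := baseChange_hom_ext fun m => by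
    rw [LinearMap.comp_apply, hι]
    simp only [ρ, Fintype.linearCombination_apply, LinearMap.comp_apply, LinearMap.pi_apply,
      LinearMap.proj_apply, LinearMap.id_apply]
    change ∑ k, f (i m k) • _ = _
    simp only [← baseChangeUnit_smul, ← map_smul, ← map_sum]
    have h1 : ∑ k, i m k • (Pi.single k 1 : Fin n → A) = i m := by
      conv_rhs => rw [← Finset.univ_sum_single (i m)]
      exact Finset.sum_congr rfl fun k _ => by rw [← Pi.single_smul, smul_eq_mul, mul_one]
    rw [h1]
    exact congrArg _ (LinearMap.congr_fun hpi m)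
  exact (hS.pi (ι := Fin n)).of_retract (ι.restrictAlong hM hfn) (ρ.restrictAlong hfn hM)
    (LinearMap.ext fun x => LinearMap.congr_fun hρι x)

theorem InvertsMaps.isLocal {S : Set (FGProjectiveMap A)} (h : InvertsMaps S f) {X : Type*}
    [AddCommGroup X] [Module A X] [Module C X] (hX : ∀ (a : A) (x : X), a • x = f a • x) :
    IsLocal S X :=
  fun σ hσ => IsLocalFor.of_baseChangeMap_bijective hX (h σ hσ)

/-- Both C ⊗ P and C ⊗ Q are local. So the unit P → C ⊗ P extends along σ to Q → C ⊗ P, and the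
C-linear map C ⊗ Q → C ⊗ P induced by it is inverse to C ⊗ σ. -/
theorem InvertsMaps.of_isLocal [Module A C] (hC : ∀ (a : A) (x : C), a • x = f a * x)
    {S : Set (FGProjectiveMap A)} (hS : IsLocal S C) : InvertsMaps S f := by
  intro σ hσ
  let _ : Module A (BaseChange f σ.source) := Module.compHom _ f
  let _ : Module A (BaseChange f σ.target) := Module.compHom _ f
  have := σ.source_projective
  have := σ.target_projective
  have := σ.source_finite
  have := σ.target_finite
  have hs := baseChange_isLocal (M := σ.source) hC hS (fun _ _ => rfl) σ hσ
  have ht := baseChange_isLocal (M := σ.target) hC hS (fun _ _ => rfl) σ hσ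
  let us : σ.source →ₗ[A] BaseChange f σ.source :=
    { baseChangeUnit f σ.source with map_smul' := baseChangeUnit_smul }
  let ut : σ.target →ₗ[A] BaseChange f σ.target :=
    { baseChangeUnit f σ.target with map_smul' := baseChangeUnit_smul }
  let bc : BaseChange f σ.source →ₗ[A] BaseChange f σ.target :=
    (baseChangeMap f σ.map).restrictAlong (f := f) (fun _ _ => rfl) (fun _ _ => rfl)
  obtain ⟨ψ, hψ⟩ := hs.exists_extension us
  obtain ⟨ψ', hψ'⟩ := exists_baseChangeLift (f := f) (fun _ _ => rfl) ψ
  have h1 : bc ∘ₗ ψ = ut := ht.ext (by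
    rw [LinearMap.comp_assoc, hψ]
    ext x
    exact baseChangeMap_unit σ.map x)
  have h2 : ψ' ∘ₗ baseChangeMap f σ.map = LinearMap.id := baseChange_hom_ext fun m => by
    rw [LinearMap.comp_apply, baseChangeMap_unit, hψ']
    exact LinearMap.congr_fun hψ m
  have h3 : baseChangeMap f σ.map ∘ₗ ψ' = LinearMap.id := baseChange_hom_ext fun m => by
    rw [LinearMap.comp_apply, hψ']
    exact LinearMap.congr_fun h1 m
  exact ⟨Function.LeftInverse.injective (g := ψ') fun x => LinearMap.congr_fun h2 x,
    Function.RightInverse.surjective (g := ψ') fun x => LinearMap.congr_fun h3 x⟩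

end BaseChangeLocal

/-! ### Maps between projective modules generated by idempotents -/

section Idempotent

/-- An element `elt` of `e A f` for idempotents `e = src` and `f = tgt`; right multiplication by
it is a homomorphism `Ae → Af`. -/
structure IdempotentMap (A : Type v) [Ring A] where
  src : A
  tgt : A
  elt : A
  src_idem : src * src = src
  tgt_idem : tgt * tgt = tgt
  src_mul : src * elt = elt
  mul_tgt : elt * tgt = elt

variable {A : Type v} [Ring A]

theorem mul_eq_of_mem_span_idempotent {e x : A} (he : e * e = e)
    (hx : x ∈ Submodule.span A {e}) : x * e = x := by
  obtain ⟨b, rfl⟩ := Submodule.mem_span_singleton.1 hx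
  rw [smul_eq_mul, mul_assoc, he]

theorem projective_span_idempotent {e : A} (he : e * e = e) :
    Module.Projective A (Submodule.span A {e}) := by
  refine Module.Projective.of_split (M := A) (Submodule.span A {e}).subtype
    ((LinearMap.toSpanSingleton A A e).codRestrict _ fun x =>
      Submodule.smul_mem _ x (Submodule.mem_span_singleton_self e)) ?_
  ext x
  exact mul_eq_of_mem_span_idempotent he x.2

theorem linearMap_span_idempotent_apply {e : A} (he : e * e = e) {M : Type*} [AddCommGroup M]
    [Module A M] (φ : Submodule.span A {e} →ₗ[A] M) (x : Submodule.span A {e}) :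
    φ x = (x : A) • φ ⟨e, Submodule.mem_span_singleton_self e⟩ := by
  rw [← map_smul]
  congr 1
  exact Subtype.ext (mul_eq_of_mem_span_idempotent he x.2).symm

namespace IdempotentMap

/-- Right multiplication by `τ.elt`. -/
def toLinearMap (τ : IdempotentMap A) :
    Submodule.span A {τ.src} →ₗ[A] Submodule.span A {τ.tgt} :=
  ((LinearMap.toSpanSingleton A A τ.elt).domRestrict (Submodule.span A {τ.src})).codRestrict
    (Submodule.span A {τ.tgt}) fun x => Submodule.mem_span_singleton.2 ⟨x * τ.elt, by
      simp [mul_assoc, τ.mul_tgt]⟩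

/-- Right multiplication by `τ.elt` as a map between finitely generated projective modules. -/
def toFGProjectiveMap (τ : IdempotentMap A) : FGProjectiveMap A where
  source := ModuleCat.of A (Submodule.span A {τ.src})
  target := ModuleCat.of A (Submodule.span A {τ.tgt})
  source_finite := Module.Finite.span_singleton A τ.src
  source_projective := projective_span_idempotent τ.src_idem
  target_finite := Module.Finite.span_singleton A τ.tgt
  target_projective := projective_span_idempotent τ.tgt_idem
  map := τ.toLinearMap

/-- `τ.elt` acts bijectively from the `τ.tgt`-part of `M` to its `τ.src`-part. -/
structure ActsBijectively (τ : IdempotentMap A) (M : Type*) [AddCommGroup M] [Module A M] :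
    Prop where
  eq_zero : ∀ m : M, τ.tgt • m = m → τ.elt • m = 0 → m = 0
  exists_eq : ∀ x : M, τ.src • x = x → ∃ m : M, τ.tgt • m = m ∧ τ.elt • m = x

/-- Evaluation at e identifies Hom(Ae, M) with eM, and composition with τ becomes the action of
`τ.elt`. -/
theorem isLocalFor_iff (τ : IdempotentMap A) (M : Type*) [AddCommGroup M] [Module A M] :
    IsLocalFor τ.toLinearMap M ↔ τ.ActsBijectively M := by
  let es : Submodule.span A {τ.src} := ⟨τ.src, Submodule.mem_span_singleton_self _⟩
  let et : Submodule.span A {τ.tgt} := ⟨τ.tgt, Submodule.mem_span_singleton_self _⟩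
  have hmap : ∀ x : Submodule.span A {τ.src},
      (τ.toLinearMap x : A) = x * τ.elt := fun _ => rfl
  let Φ : M → (Submodule.span A {τ.tgt} →ₗ[A] M) := fun m =>
    (LinearMap.toSpanSingleton A M m).domRestrict _
  have hΦ : ∀ m x, Φ m x = (x : A) • m := fun _ _ => rfl
  constructor
  · intro h
    refine ⟨fun m hm h0 => ?_, fun x hx => ?_⟩
    · have h1 : Φ m = 0 := h.eq_zero (by
        refine LinearMap.ext fun x => ?_
        change Φ m (τ.toLinearMap x) = 0
        rw [hΦ, hmap, mul_smul, h0, smul_zero])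
      have := LinearMap.congr_fun h1 et
      rwa [hΦ, show ((et : A) • m) = m from hm] at this
    · obtain ⟨φ, hφ⟩ := h.exists_extension
        (((LinearMap.toSpanSingleton A M x).domRestrict _) : Submodule.span A {τ.src} →ₗ[A] M)
      have hm : φ et = τ.tgt • φ et := linearMap_span_idempotent_apply τ.tgt_idem φ et
      refine ⟨φ et, hm.symm, ?_⟩
      have h1 : φ (τ.toLinearMap es) = τ.src • x := LinearMap.congr_fun hφ es
      rw [hx] at h1
      rw [← h1, linearMap_span_idempotent_apply τ.tgt_idem φ (τ.toLinearMap es), hmap]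
      change τ.elt • φ et = (τ.src * τ.elt) • φ et
      rw [τ.src_mul]
  · intro h
    refine ⟨fun φ₁ φ₂ h₁₂ => ?_, fun θ => ?_⟩
    · rw [← sub_eq_zero]
      have hφ : (φ₁ - φ₂) ∘ₗ τ.toLinearMap = 0 := by
        rw [LinearMap.sub_comp, sub_eq_zero]; exact h₁₂
      generalize φ₁ - φ₂ = φ at hφ
      have hm : φ et = τ.tgt • φ et := linearMap_span_idempotent_apply τ.tgt_idem φ et
      have h1 : φ (τ.toLinearMap es) = 0 := LinearMap.congr_fun hφ es
      rw [linearMap_span_idempotent_apply τ.tgt_idem φ (τ.toLinearMap es), hmap] at h1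
      change (τ.src * τ.elt) • φ et = 0 at h1
      rw [τ.src_mul] at h1
      refine LinearMap.ext fun x => ?_
      rw [linearMap_span_idempotent_apply τ.tgt_idem φ x]
      change (x : A) • φ et = 0
      rw [h.eq_zero _ hm.symm h1, smul_zero]
    · have hx : θ es = τ.src • θ es := linearMap_span_idempotent_apply τ.src_idem θ es
      obtain ⟨m, hm, hm'⟩ := h.exists_eq (θ es) hx.symm
      refine ⟨Φ m, LinearMap.ext fun x => ?_⟩
      rw [linearMap_span_idempotent_apply τ.src_idem θ x]
      change Φ m (τ.toLinearMap x) = (x : A) • θ es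
      rw [hΦ, hmap, mul_smul, hm']

end IdempotentMap

theorem isLocal_image_iff {T : Set (IdempotentMap A)} {M : Type*} [AddCommGroup M]
    [Module A M] : IsLocal (IdempotentMap.toFGProjectiveMap '' T) M ↔
      ∀ τ ∈ T, τ.ActsBijectively M := by
  constructor
  · exact fun h τ hτ => (τ.isLocalFor_iff M).1 (h _ ⟨τ, hτ, rfl⟩)
  · rintro h _ ⟨τ, hτ, rfl⟩
    exact (τ.isLocalFor_iff M).2 (h τ hτ)

/-- `g : A → C` inverts right multiplication by `τ.elt` if and only if `g τ.elt` has an inverse in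
`g τ.tgt * C * g τ.src`. -/
theorem invertsMaps_image_iff {T : Set (IdempotentMap A)} {C : Type v} [Ring C] (g : A →+* C) :
    InvertsMaps (IdempotentMap.toFGProjectiveMap '' T) g ↔
      ∀ τ ∈ T, ∃ b : C, g τ.tgt * b * g τ.src = b ∧ g τ.elt * b = g τ.src ∧
        b * g τ.elt = g τ.tgt := by
  let _ : Module A C := Module.compHom C g
  have hC : ∀ (a : A) (x : C), a • x = g a * x := fun _ _ => rfl
  constructor
  · intro h τ hτ
    obtain ⟨h1, h2⟩ := isLocal_image_iff.1 (h.isLocal (X := C) hC) τ hτ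
    obtain ⟨b, hb, hb'⟩ := h2 (g τ.src) (by rw [hC, ← map_mul, τ.src_idem])
    rw [hC] at hb hb'
    have hbe : b * g τ.src = b := by
      rw [← sub_eq_zero]
      apply h1
      · rw [hC, mul_sub, ← mul_assoc, hb]
      · rw [hC, mul_sub, ← mul_assoc, hb', ← map_mul, τ.src_idem, sub_self]
    refine ⟨b, by rw [hb, hbe], hb', ?_⟩
    rw [← sub_eq_zero]
    apply h1
    · rw [hC, mul_sub, ← mul_assoc, hb, ← map_mul, τ.tgt_idem]
    · rw [hC, mul_sub, ← mul_assoc, hb', ← map_mul, ← map_mul, τ.src_mul, τ.mul_tgt, sub_self]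
  · intro h
    refine InvertsMaps.of_isLocal hC (isLocal_image_iff.2 fun τ hτ => ?_)
    obtain ⟨b, hb, hb1, hb2⟩ := h τ hτ
    refine ⟨fun m hm h0 => ?_, fun x hx => ⟨b * x, ?_, ?_⟩⟩
    · rw [hC] at hm h0
      rw [← hm, ← hb2, mul_assoc, h0, mul_zero]
    · rw [hC, ← mul_assoc]
      conv_lhs => rw [← hb]
      rw [← mul_assoc, ← mul_assoc, ← map_mul, τ.tgt_idem, hb]
    · rw [hC] at hx ⊢
      rw [← mul_assoc, hb1, hx]

/-- The relations defining the universal localisation at a set of maps between modules generated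
by idempotents. -/
inductive LocalisationRel (T : Set (IdempotentMap A)) :
    FreeAlgebra ℤ (A ⊕ T) → FreeAlgebra ℤ (A ⊕ T) → Prop
  | one : LocalisationRel T (FreeAlgebra.ι ℤ (Sum.inl 1)) 1
  | add (a b : A) : LocalisationRel T (FreeAlgebra.ι ℤ (Sum.inl (a + b)))
      (FreeAlgebra.ι ℤ (Sum.inl a) + FreeAlgebra.ι ℤ (Sum.inl b))
  | mul (a b : A) : LocalisationRel T (FreeAlgebra.ι ℤ (Sum.inl (a * b)))
      (FreeAlgebra.ι ℤ (Sum.inl a) * FreeAlgebra.ι ℤ (Sum.inl b))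
  | corner (τ : T) : LocalisationRel T (FreeAlgebra.ι ℤ (Sum.inl τ.1.tgt) *
      FreeAlgebra.ι ℤ (Sum.inr τ) * FreeAlgebra.ι ℤ (Sum.inl τ.1.src)) (FreeAlgebra.ι ℤ (Sum.inr τ))
  | right_inv (τ : T) : LocalisationRel T (FreeAlgebra.ι ℤ (Sum.inl τ.1.elt) *
      FreeAlgebra.ι ℤ (Sum.inr τ)) (FreeAlgebra.ι ℤ (Sum.inl τ.1.src))
  | left_inv (τ : T) : LocalisationRel T (FreeAlgebra.ι ℤ (Sum.inr τ) *
      FreeAlgebra.ι ℤ (Sum.inl τ.1.elt)) (FreeAlgebra.ι ℤ (Sum.inl τ.1.tgt))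

/-- Adjoin to A a formal inverse of each `τ.elt`. The corner relation forces it into the corner
where inverses are unique, which gives uniqueness of the factorisation. -/
theorem exists_isUniversalLocalisationAt (T : Set (IdempotentMap A)) :
    ∃ (B : Type v) (_ : Ring B) (f : A →+* B),
      IsUniversalLocalisationAt (IdempotentMap.toFGProjectiveMap '' T) f := by
  let q := RingQuot.mkAlgHom ℤ (LocalisationRel T)
  have hq {x y} (h : LocalisationRel T x y) : q x = q y := RingQuot.mkAlgHom_rel ℤ h
  let x : A ⊕ T → RingQuot (LocalisationRel T) := fun s => q (FreeAlgebra.ι ℤ s)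
  let f : A →+* RingQuot (LocalisationRel T) := RingHom.mk'
    { toFun := fun a => x (Sum.inl a)
      map_one' := (hq .one).trans (map_one q)
      map_mul' := fun a b => (hq (.mul a b)).trans (map_mul q _ _) }
    fun a b => (hq (.add a b)).trans (map_add q _ _)
  have hf : ∀ a, q (FreeAlgebra.ι ℤ (Sum.inl a)) = f a := fun _ => rfl
  refine ⟨RingQuot (LocalisationRel T), inferInstance, f, ?_, ?_⟩
  · refine (invertsMaps_image_iff f).2 fun τ hτ => ⟨q (FreeAlgebra.ι ℤ (Sum.inr ⟨τ, hτ⟩)), ?_, ?_, ?_⟩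
    · have := hq (.corner ⟨τ, hτ⟩)
      rwa [map_mul, map_mul, hf, hf] at this
    · have := hq (.right_inv ⟨τ, hτ⟩)
      rwa [map_mul, hf, hf] at this
    · have := hq (.left_inv ⟨τ, hτ⟩)
      rwa [map_mul, hf, hf] at this
  · intro C _ g hg
    rw [invertsMaps_image_iff] at hg
    choose b hb using fun τ : T => hg τ.1 τ.2
    let F : FreeAlgebra ℤ (A ⊕ T) →ₐ[ℤ] C := FreeAlgebra.lift ℤ (Sum.elim g b)
    have hFl : ∀ a, F (FreeAlgebra.ι ℤ (Sum.inl a)) = g a := fun a => by simp [F]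
    have hFr : ∀ τ, F (FreeAlgebra.ι ℤ (Sum.inr τ)) = b τ := fun a => by simp [F]
    have hF : ∀ ⦃x y⦄, LocalisationRel T x y → F x = F y := by
      intro x y h
      cases h with
      | one => simp only [hFl, map_one]
      | add => simp only [hFl, map_add]
      | mul => simp only [hFl, map_mul]
      | corner τ => simp only [hFl, hFr, map_mul, (hb τ).1]
      | right_inv τ => simp only [hFl, hFr, map_mul, (hb τ).2.1]
      | left_inv τ => simp only [hFl, hFr, map_mul, (hb τ).2.2]
    let h := RingQuot.liftAlgHom ℤ ⟨F, hF⟩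
    have hh : ∀ y, h (q y) = F y := fun y => RingQuot.liftAlgHom_mkAlgHom_apply ℤ F hF y
    refine ⟨(h : _ →+* C), ?_, ?_⟩
    · ext a
      exact (hh _).trans (hFl a)
    · intro k hk
      have hk' : ∀ a, k (f a) = g a := fun a => RingHom.congr_fun hk a
      have hkh : k.toIntAlgHom = h := by
        refine RingQuot.ringQuot_ext' ℤ _ _ (FreeAlgebra.hom_ext (funext fun s => ?_))
        rcases s with a | τ
        · exact (hk' a).trans ((hh _).trans (hFl a)).symm
        · change k (q (FreeAlgebra.ι ℤ (Sum.inr τ))) = h (q (FreeAlgebra.ι ℤ (Sum.inr τ)))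
          rw [hh, hFr]
          set c := k (q (FreeAlgebra.ι ℤ (Sum.inr τ)))
          -- Inverses in the corner agree: c = c · src = c · elt · b = tgt · b = b.
          have h1 : g τ.1.tgt * c * g τ.1.src = c := by
            have := congrArg k (hq (.corner τ))
            simpa only [map_mul, hf, hk'] using this
          have h3 : c * g τ.1.elt = g τ.1.tgt := by
            have := congrArg k (hq (.left_inv τ))
            simpa only [map_mul, hf, hk'] using this
          obtain ⟨b1, b2, b3⟩ := hb τ
          have hc : c * g τ.1.src = c := by
            rw [← h1, mul_assoc, ← map_mul, τ.1.src_idem]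
          have hb' : g τ.1.tgt * b τ = b τ := by
            conv_lhs => rw [← b1]
            rw [← mul_assoc, ← mul_assoc, ← map_mul, τ.1.tgt_idem, b1]
          rw [← hc, ← b2, ← mul_assoc, h3, hb']
      exact RingHom.ext fun y => AlgHom.congr_fun hkh y

end Idempotent

/-! ### Uniserial modules -/

section Uniserial

variable {A : Type*} [Ring A] {M N : Type*} [AddCommGroup M] [Module A M] [AddCommGroup N]
  [Module A N]

theorem IsUniserialModule.of_surjective (h : IsUniserialModule A M) (φ : M →ₗ[A] N)
    (hφ : Function.Surjective φ) : IsUniserialModule A N := fun L L' => by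
  rw [← Submodule.map_comap_eq_of_surjective hφ L, ← Submodule.map_comap_eq_of_surjective hφ L']
  exact (h (L.comap φ) (L'.comap φ)).imp (Submodule.map_mono ·) (Submodule.map_mono ·)

theorem IsUniserialModule.of_injective (h : IsUniserialModule A N) (φ : M →ₗ[A] N)
    (hφ : Function.Injective φ) : IsUniserialModule A M := fun L L' =>
  (h (L.map φ) (L'.map φ)).imp (Submodule.map_le_map_iff_of_injective hφ L L').1
    (Submodule.map_le_map_iff_of_injective hφ L' L).1

/-- A nonzero uniserial artinian module has an element which lies in all nonzero submodules. -/
theorem IsUniserialModule.exists_mem_of_ne_bot [IsArtinian A M] [Nontrivial M]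
    (h : IsUniserialModule A M) : ∃ z : M, z ≠ 0 ∧ ∀ L : Submodule A M, L ≠ ⊥ → z ∈ L := by
  obtain ⟨L, hL, hmin⟩ := IsArtinian.set_has_minimal {L : Submodule A M | L ≠ ⊥} ⟨⊤, top_ne_bot⟩
  obtain ⟨z, hz, hz0⟩ := Submodule.exists_mem_ne_zero_of_ne_bot hL
  refine ⟨z, hz0, fun L' hL' => ?_⟩
  rcases h L L' with h1 | h1
  · exact h1 hz
  · rwa [h1.eq_of_not_lt (hmin L' hL')]

theorem exists_linearMap_span_singleton {x : M} {y : N} (h : ∀ a : A, a • x = 0 → a • y = 0) :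
    ∃ φ : Submodule.span A {x} →ₗ[A] N, ∀ a : A, ∀ z : Submodule.span A {x},
      (z : M) = a • x → φ z = a • y := by
  have hker : ∀ a b : A, a • x = b • x → a • y = b • y := fun a b hab => by
    rw [← sub_eq_zero, ← sub_smul]
    exact h _ (by rw [sub_smul, hab, sub_self])
  choose c hc using fun z : Submodule.span A {x} => Submodule.mem_span_singleton.1 z.2
  have key : ∀ (a : A) (z : Submodule.span A {x}), (z : M) = a • x → c z • y = a • y :=
    fun a z hz => hker _ _ ((hc z).trans hz)
  refine ⟨{ toFun := fun z => c z • y, map_add' := fun z w => ?_, map_smul' := fun a z => ?_ }, key⟩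
  · rw [← add_smul]
    exact key _ _ (by rw [Submodule.coe_add, ← hc z, ← hc w, add_smul])
  · rw [RingHom.id_apply, smul_smul]
    exact key _ _ (by rw [Submodule.coe_smul, ← hc z, smul_smul])

end Uniserial

/-! ### Primitive idempotents -/

section Primitive

/-- A nonzero idempotent which is not the sum of two nonzero orthogonal idempotents. -/
structure IsPrimitiveIdempotent {A : Type*} [Ring A] (e : A) : Prop where
  ne_zero : e ≠ 0
  idem : e * e = e
  eq_zero_or_eq : ∀ x : A, x * x = x → e * x = x → x * e = x → x = 0 ∨ x = e

variable {A : Type v} [Ring A]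

/-- Well-founded induction on Ae, splitting e as x + (e - x). Orthogonality of the summands is not
needed later, so only membership in the additive closure is recorded. -/
theorem exists_primitive_decomposition [IsArtinianRing A] (e : A) (he : e * e = e) :
    ∃ s : Finset A, (∀ g ∈ s, IsPrimitiveIdempotent g) ∧ e ∈ AddSubmonoid.closure (s : Set A) := by
  classical
  induction hN : Submodule.span A {e} using WellFoundedLT.induction generalizing e with
  | ind N ih =>
    subst hN
    by_cases h0 : e = 0
    · exact ⟨∅, by simp, h0 ▸ zero_mem _⟩
    by_cases hp : IsPrimitiveIdempotent e
    · exact ⟨{e}, by simpa using hp, AddSubmonoid.subset_closure (by simp)⟩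
    obtain ⟨x, hxx, hex, hxe, hx0, hxe'⟩ : ∃ x : A, x * x = x ∧ e * x = x ∧ x * e = x ∧ x ≠ 0 ∧
        x ≠ e := by
      by_contra! hcon
      refine hp ⟨h0, he, fun x h1 h2 h3 => ?_⟩
      by_contra! h4
      exact h4.2 (hcon x h1 h2 h3 h4.1)
    have lt : ∀ y : A, y * y = y → e * y = y → y * e = y → y ≠ e →
        Submodule.span A {y} < Submodule.span A {e} := fun y hyy hey hye hne => by
      refine lt_of_le_of_ne ?_ fun heq => hne ?_
      · rw [Submodule.span_singleton_le_iff_mem]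
        exact Submodule.mem_span_singleton.2 ⟨y, hye⟩
      · have : e ∈ Submodule.span A {y} := heq ▸ Submodule.mem_span_singleton_self e
        rw [← hey]
        exact mul_eq_of_mem_span_idempotent hyy this
    have hy : (e - x) * (e - x) = e - x := by
      rw [mul_sub, sub_mul, sub_mul, he, hxe, hex, hxx]; abel
    obtain ⟨s, hs, hxs⟩ := ih _ (lt x hxx hex hxe hxe') x hxx rfl
    obtain ⟨t, ht, hyt⟩ := ih _ (lt (e - x) hy (by rw [mul_sub, he, hex])
      (by rw [sub_mul, he, hxe]) (by simpa using hx0)) (e - x) hy rfl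
    refine ⟨s ∪ t, fun g hg => (Finset.mem_union.1 hg).elim (hs g) (ht g), ?_⟩
    rw [← add_sub_cancel x e]
    exact add_mem (AddSubmonoid.closure_mono (by simp) hxs)
      (AddSubmonoid.closure_mono (by simp) hyt)

theorem mem_of_forall_smul_mem {M : Type*} [AddCommGroup M] [Module A M] {s : Finset A}
    (hs : (1 : A) ∈ AddSubmonoid.closure (s : Set A)) {N : AddSubmonoid M} {x : M}
    (h : ∀ g ∈ s, g • x ∈ N) : x ∈ N := by
  suffices ∀ a ∈ AddSubmonoid.closure (s : Set A), a • x ∈ N by simpa using this 1 hs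
  intro a ha
  induction ha using AddSubmonoid.closure_induction with
  | mem g hg => exact h g hg
  | zero => rw [zero_smul]; exact zero_mem _
  | add a b _ _ ha hb => rw [add_smul]; exact add_mem ha hb

theorem exists_primitive_smul_notMem [IsArtinianRing A] {M : Type*} [AddCommGroup M] [Module A M]
    {N : AddSubmonoid M} {x : M} (h : x ∉ N) :
    ∃ g : A, IsPrimitiveIdempotent g ∧ g • x ∉ N := by
  obtain ⟨s, hs, h1⟩ := exists_primitive_decomposition (1 : A) (mul_one 1)
  by_contra! hcon
  exact h (mem_of_forall_smul_mem h1 fun g hg => hcon g (hs g hg))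

theorem exists_primitive_smul_ne_zero [IsArtinianRing A] {M : Type*} [AddCommGroup M] [Module A M]
    {x : M} (h : x ≠ 0) : ∃ g : A, IsPrimitiveIdempotent g ∧ g • x ≠ 0 := by
  simpa using exists_primitive_smul_notMem (A := A) (N := (⊥ : AddSubmonoid M)) (x := x) (by simpa)

namespace IsPrimitiveIdempotent

variable {e : A} (he : IsPrimitiveIdempotent e)
include he

/-- Splitting e = n + n' along a decomposition of Ae produces an idempotent n of eAe, which must be
0 or e. -/
theorem isIndecomposableModule_span : IsIndecomposableModule A (Submodule.span A {e}) := by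
  let u : Submodule.span A {e} := ⟨e, Submodule.mem_span_singleton_self e⟩
  have hu0 : u ≠ 0 := fun h => he.ne_zero (congrArg Subtype.val h)
  refine ⟨⟨u, 0, hu0⟩, fun N N' h => ?_⟩
  have aux : ∀ L : Submodule A (Submodule.span A {e}), u ∈ L → L = ⊤ := fun L hL => by
    rw [eq_top_iff]
    rintro ⟨x, hx⟩ -
    have : (⟨x, hx⟩ : Submodule.span A {e}) = x • u :=
      Subtype.ext (mul_eq_of_mem_span_idempotent he.idem hx).symm
    rw [this]
    exact L.smul_mem x hL
  obtain ⟨n, hn, n', hn', hsum⟩ := Submodule.mem_sup.1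
    (show u ∈ N ⊔ N' from h.sup_eq_top ▸ Submodule.mem_top)
  have hs : (n : A) + n' = e := congrArg Subtype.val hsum
  have hne : (n : A) * e = n := mul_eq_of_mem_span_idempotent he.idem n.2
  have hne' : (n' : A) * e = n' := mul_eq_of_mem_span_idempotent he.idem n'.2
  have h0 : ∀ x, x ∈ N → x ∈ N' → x = 0 := fun x h1 h2 =>
    (Submodule.mem_bot A).1 (h.inf_eq_bot ▸ Submodule.mem_inf.2 ⟨h1, h2⟩)
  have h1 : (n : A) • n' = 0 := h0 _ (by
    have : (n : A) • n' = n - (n : A) • n := Subtype.ext (by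
      change (n : A) * n' = n - n * n
      rw [eq_sub_iff_add_eq, add_comm, ← mul_add, hs, hne])
    rw [this]
    exact sub_mem hn (N.smul_mem _ hn)) (N'.smul_mem _ hn')
  have h2 : (n' : A) • n = 0 := h0 _ (N.smul_mem _ hn) (by
    have : (n' : A) • n = n' - (n' : A) • n' := Subtype.ext (by
      change (n' : A) * n = n' - n' * n'
      rw [eq_sub_iff_add_eq, ← mul_add, hs, hne'])
    rw [this]
    exact sub_mem hn' (N'.smul_mem _ hn'))
  have h1' : (n : A) * n' = 0 := congrArg Subtype.val h1
  have h2' : (n' : A) * n = 0 := congrArg Subtype.val h2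
  have hnn : (n : A) * n = n := by
    have := mul_add (n : A) n n'
    rwa [hs, hne, h1', add_zero, eq_comm] at this
  have hen : e * (n : A) = n := by
    have := add_mul (n : A) n' n
    rwa [hs, h2', add_zero, hnn] at this
  rcases he.eq_zero_or_eq n hnn hen hne with h3 | h3
  · left
    have : u = n' := Subtype.ext (by rw [h3, zero_add] at hs; exact hs.symm)
    have hN' := aux N' (this ▸ hn')
    simpa [hN'] using h.inf_eq_bot
  · right
    have : u = n := Subtype.ext h3.symm
    have hN := aux N (this ▸ hn)
    simpa [hN] using h.inf_eq_bot

theorem isUniserialModule_span (hA : IsNakayama A) :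
    IsUniserialModule A (Submodule.span A {e}) :=
  hA.projective_uniserial _ (Module.Finite.span_singleton A e)
    (projective_span_idempotent he.idem) he.isIndecomposableModule_span

/-- The two annihilators correspond to the kernels of the maps Ae → M and Ae → N given by x and y,
which are comparable because Ae is uniserial. -/
theorem annihilator_le_or_le (hA : IsNakayama A) {M N : Type*} [AddCommGroup M] [Module A M]
    [AddCommGroup N] [Module A N] {x : M} {y : N} (hx : e • x = x) (hy : e • y = y) :
    (∀ a : A, a • x = 0 → a • y = 0) ∨ ∀ a : A, a • y = 0 → a • x = 0 := by
  let u : Submodule.span A {e} := ⟨e, Submodule.mem_span_singleton_self e⟩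
  let φ := (LinearMap.toSpanSingleton A M x).domRestrict (Submodule.span A {e})
  let ψ := (LinearMap.toSpanSingleton A N y).domRestrict (Submodule.span A {e})
  have hφ : ∀ a : A, φ (a • u) = a • x := fun a => by
    change (a * e) • x = _
    rw [mul_smul, hx]
  have hψ : ∀ a : A, ψ (a • u) = a • y := fun a => by
    change (a * e) • y = _
    rw [mul_smul, hy]
  refine (he.isUniserialModule_span hA (LinearMap.ker φ) (LinearMap.ker ψ)).imp
    (fun h a ha => ?_) (fun h a ha => ?_)
  · rw [← hψ]; exact h ((hφ a).trans ha)
  · rw [← hφ]; exact h ((hψ a).trans ha)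

theorem isUniserialModule_span_singleton (hA : IsNakayama A) {M : Type*} [AddCommGroup M]
    [Module A M] {x : M} (hx : e • x = x) : IsUniserialModule A (Submodule.span A {x}) := by
  refine (he.isUniserialModule_span hA).of_surjective
    (((LinearMap.toSpanSingleton A M x).domRestrict (Submodule.span A {e})).codRestrict _
      fun a => Submodule.smul_mem _ _ (Submodule.mem_span_singleton_self x)) ?_
  rintro ⟨y, hy⟩
  obtain ⟨a, rfl⟩ := Submodule.mem_span_singleton.1 hy
  refine ⟨⟨a * e, Submodule.mem_span_singleton.2 ⟨a, rfl⟩⟩, Subtype.ext ?_⟩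
  change (a * e) • x = a • x
  rw [mul_smul, hx]

/-- This is locality of Ae. If a maximal left ideal m misses z, then e = ek + ebz with k in m.
Comparing m ∩ Ae with Az inside Ae puts ek into Az, as the other inclusion would put z into m. -/
theorem mem_jacobson_or_mem_span (hA : IsNakayama A) {z : A} (hz : z * e = z) :
    z ∈ Ring.jacobson A ∨ e ∈ Submodule.span A {z} := by
  by_contra! hcon
  obtain ⟨hz1, hz2⟩ := hcon
  apply hz1
  rw [← Ideal.jacobson_bot, Ideal.jacobson, Ideal.mem_sInf]
  rintro m ⟨-, hm⟩
  by_contra hzm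
  have hze : ∀ b : A, b * z ∈ Submodule.span A {e} := fun b =>
    Submodule.mem_span_singleton.2 ⟨b * z, by rw [smul_eq_mul, mul_assoc, hz]⟩
  have h1 : (1 : A) ∈ m ⊔ Submodule.span A {z} := by
    rw [hm.1.2 _ (lt_of_le_of_ne le_sup_left fun h =>
      hzm (h ▸ (le_sup_right (a := m)) (Submodule.mem_span_singleton_self z)))]
    exact Submodule.mem_top
  obtain ⟨k, hk, y, hy, hky⟩ := Submodule.mem_sup.1 h1
  obtain ⟨b, rfl⟩ := Submodule.mem_span_singleton.1 hy
  have hek : e * k = e - (e * b) * z := by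
    rw [eq_sub_iff_add_eq, mul_assoc, ← mul_add]
    change e * (k + b • z) = e
    rw [hky, mul_one]
  have hekm : e - (e * b) * z ∈ m := hek ▸ m.mul_mem_left e hk
  rcases he.isUniserialModule_span hA (Submodule.comap (Submodule.span A {e}).subtype m)
    ((Submodule.span A {z}).comap (Submodule.span A {e}).subtype) with h | h
  · have h3 := @h ⟨e - (e * b) * z, sub_mem (Submodule.mem_span_singleton_self e) (hze _)⟩ hekm
    have h4 : e - (e * b) * z ∈ Submodule.span A {z} := h3
    have h5 : (e * b) * z ∈ Submodule.span A {z} := Submodule.mem_span_singleton.2 ⟨e * b, rfl⟩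
    exact hz2 (by simpa using add_mem h4 h5)
  · exact hzm (@h ⟨z, by simpa using hze 1⟩ (Submodule.mem_span_singleton_self z))

theorem mem_jacobson_smul_or_mem_span (hA : IsNakayama A) {M : Type*} [AddCommGroup M]
    [Module A M] {x u : M} (hx : e • x = x) (hu : u ∈ Submodule.span A {x}) :
    (∃ j ∈ Ring.jacobson A, u = j • x) ∨ x ∈ Submodule.span A {u} := by
  obtain ⟨a, rfl⟩ := Submodule.mem_span_singleton.1 hu
  rcases he.mem_jacobson_or_mem_span hA (z := a * e) (by rw [mul_assoc, he.idem]) with h | h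
  · exact Or.inl ⟨a * e, h, by rw [mul_smul, hx]⟩
  · obtain ⟨b, hb⟩ := Submodule.mem_span_singleton.1 h
    refine Or.inr (Submodule.mem_span_singleton.2 ⟨b, ?_⟩)
    conv_rhs => rw [← hx, ← hb]
    rw [smul_eq_mul, mul_smul, mul_smul, hx]

end IsPrimitiveIdempotent

end Primitive

/-! ### Duals of right projective modules -/

section Codual

variable (K : Type v) [Field K] (A : Type v) [Ring A] [Algebra K A]

/-- The `K`-dual of the right module `A`, a left module. -/
def Codual : Type v := A →ₗ[K] K

namespace Codual

noncomputable instance : AddCommGroup (Codual K A) := inferInstanceAs (AddCommGroup (A →ₗ[K] K))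

noncomputable instance : Module K (Codual K A) := inferInstanceAs (Module K (A →ₗ[K] K))

instance : FunLike (Codual K A) A K := inferInstanceAs (FunLike (A →ₗ[K] K) A K)

instance : LinearMapClass (Codual K A) K A K :=
  inferInstanceAs (LinearMapClass (A →ₗ[K] K) K A K)

instance [FiniteDimensional K A] : FiniteDimensional K (Codual K A) :=
  inferInstanceAs (FiniteDimensional K (A →ₗ[K] K))

variable {K A}

@[ext]
theorem ext {l m : Codual K A} (h : ∀ a, l a = m a) : l = m := DFunLike.ext l m h

theorem add_apply (l m : Codual K A) (a : A) : (l + m) a = l a + m a := rfl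

theorem smul_field_apply (k : K) (l : Codual K A) (a : A) : (k • l) a = k * l a := rfl

theorem zero_apply (a : A) : (0 : Codual K A) a = 0 := rfl

noncomputable instance : SMul A (Codual K A) where
  smul b l := (l : A →ₗ[K] K) ∘ₗ LinearMap.mulRight K b

theorem smul_apply (b : A) (l : Codual K A) (a : A) : (b • l) a = l (a * b) := rfl

noncomputable instance : Module A (Codual K A) where
  one_smul l := by ext a; rw [smul_apply, mul_one]
  mul_smul b c l := by ext a; rw [smul_apply, smul_apply, smul_apply, mul_assoc]
  smul_zero b := rfl
  smul_add b l m := rfl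
  add_smul b c l := by ext a; rw [smul_apply, mul_add, map_add]; rfl
  zero_smul l := by ext a; rw [smul_apply, mul_zero, map_zero]; rfl

instance : IsScalarTower K A (Codual K A) where
  smul_assoc k b l := by
    ext a
    rw [smul_apply, smul_field_apply, smul_apply, mul_smul_comm, map_smul, smul_eq_mul]

/-- The dual of `eA`, realised as the functionals on `A` which factor through `a ↦ e a`. -/
def corner (e : A) : Submodule A (Codual K A) where
  carrier := {l | ∀ a, l (e * a) = l a}
  add_mem' hl hm a := by rw [add_apply, add_apply, hl, hm]
  zero_mem' a := rfl
  smul_mem' b l hl a := by rw [smul_apply, smul_apply, mul_assoc, hl]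

/-- The functional `a ↦ μ (e a)` in the dual of `eA`. -/
noncomputable def toCorner {e : A} (he : e * e = e) (μ : A →ₗ[K] K) : corner (K := K) e :=
  ⟨(μ ∘ₗ LinearMap.mulLeft K e : A →ₗ[K] K), fun a => by
    change μ (e * (e * a)) = μ (e * a)
    rw [← mul_assoc, he]⟩

theorem toCorner_apply {e : A} (he : e * e = e) (μ : A →ₗ[K] K) (a : A) :
    (toCorner he μ : Codual K A) a = μ (e * a) := rfl

/-- One direction of Hom_A(M, D(eA)) ≅ D(eM). It reduces the construction of maps into D(eA) to that
of K-linear functionals. -/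
theorem exists_linearMap_corner {e : A} (he : e * e = e) {M : Type*} [AddCommGroup M] [Module A M]
    [Module K M] [IsScalarTower K A M] (μ : M →ₗ[K] K) :
    ∃ φ : M →ₗ[A] corner (K := K) e, ∀ m a, (φ m : Codual K A) a = μ ((e * a) • m) := by
  refine ⟨{ toFun := fun m => toCorner he (μ ∘ₗ (LinearMap.toSpanSingleton A M m).restrictScalars K)
            map_add' := fun x y => ?_, map_smul' := fun a x => ?_ }, fun m a => rfl⟩
  · refine Subtype.ext (Codual.ext fun b => ?_)
    change μ ((e * b) • (x + y)) = μ ((e * b) • x) + μ ((e * b) • y)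
    rw [smul_add, map_add]
  · refine Subtype.ext (Codual.ext fun b => ?_)
    change μ ((e * b) • a • x) = μ ((e * (b * a)) • x)
    rw [smul_smul, mul_assoc]

/-- A map g into D(eA) is recovered from the functional x ↦ g(x)(1), and this functional extends to
Y through a K-linear retraction of f. -/
theorem injective_corner {e : A} (he : e * e = e) : Module.Injective A (corner (K := K) e) where
  out X Y _ _ _ _ f hf g := by
    let _ : Module K X := Module.compHom X (algebraMap K A)
    let _ : Module K Y := Module.compHom Y (algebraMap K A)
    have _ : IsScalarTower K A X := IsScalarTower.of_algebraMap_smul fun _ _ => rfl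
    have _ : IsScalarTower K A Y := IsScalarTower.of_algebraMap_smul fun _ _ => rfl
    let fK : X →ₗ[K] Y := f.restrictScalars K
    obtain ⟨r, hr⟩ := fK.exists_leftInverse_of_injective (LinearMap.ker_eq_bot.2 hf)
    let ev : X →ₗ[K] K :=
      { toFun := fun x => (g x : Codual K A) 1
        map_add' := fun x y => by rw [map_add]; rfl
        map_smul' := fun k x => by
          change (g (algebraMap K A k • x) : Codual K A) 1 = k * _
          rw [map_smul, Submodule.coe_smul, smul_apply, one_mul, Algebra.algebraMap_eq_smul_one,
            map_smul, smul_eq_mul] }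
    obtain ⟨h, hh⟩ := exists_linearMap_corner he (ev ∘ₗ r)
    refine ⟨h, fun x => Subtype.ext (Codual.ext fun a => ?_)⟩
    rw [hh]
    have h1 : r ((e * a) • f x) = (e * a) • x := by
      rw [← map_smul]
      exact LinearMap.congr_fun hr _
    rw [LinearMap.comp_apply, h1]
    change (g ((e * a) • x) : Codual K A) 1 = _
    rw [map_smul, Submodule.coe_smul, smul_apply, one_mul, (g x).2]

/-- Endomorphisms of D(eA) come from elements of eAe by biduality. The projection onto a summand
thus gives an idempotent of eAe, which is 0 or e. -/
theorem isIndecomposableModule_corner [FiniteDimensional K A] {e : A}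
    (he : IsPrimitiveIdempotent e) : IsIndecomposableModule A (corner (K := K) e) := by
  have sep : ∀ x y : A, (∀ μ : A →ₗ[K] K, μ x = μ y) → x = y := fun x y h => by
    rw [← sub_eq_zero, ← Module.forall_dual_apply_eq_zero_iff K]
    intro μ
    rw [map_sub, h, sub_self]
  constructor
  · obtain ⟨μ, hμ⟩ : ∃ μ : A →ₗ[K] K, μ e ≠ 0 := by
      by_contra! h
      exact he.ne_zero ((Module.forall_dual_apply_eq_zero_iff K e).1 h)
    refine ⟨toCorner he.idem μ, 0, fun h => hμ ?_⟩
    have := DFunLike.congr_fun (congrArg Subtype.val h) (1 : A)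
    rwa [toCorner_apply, mul_one] at this
  · intro N N' hN
    let π : corner (K := K) e →ₗ[A] corner (K := K) e :=
      N.subtype ∘ₗ Submodule.projectionOnto N N' hN
    -- In finite dimension this element of the bidual is evaluation at some x, and then π l = l(x
    -- ·).
    let Θ : Module.Dual K (Module.Dual K A) :=
      { toFun := fun μ => (π (toCorner he.idem μ) : Codual K A) 1
        map_add' := fun μ ν => by
          have : toCorner he.idem (μ + ν) = toCorner he.idem μ + toCorner he.idem ν := rfl
          rw [this, map_add]; rfl
        map_smul' := fun k μ => by
          have : toCorner he.idem (k • μ) = algebraMap K A k • toCorner he.idem μ := by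
            refine Subtype.ext (Codual.ext fun a => ?_)
            rw [Submodule.coe_smul, smul_apply, toCorner_apply, toCorner_apply,
              LinearMap.smul_apply, ← Algebra.commutes, ← Algebra.smul_def, mul_smul_comm, map_smul]
          rw [this, map_smul, Submodule.coe_smul, smul_apply, one_mul,
            Algebra.algebraMap_eq_smul_one, map_smul, RingHom.id_apply] }
    obtain ⟨x, hx⟩ := (Module.evalEquiv K A).surjective Θ
    have hx' : ∀ μ : A →ₗ[K] K, (π (toCorner he.idem μ) : Codual K A) 1 = μ x := fun μ =>
      (LinearMap.congr_fun hx μ).symm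
    have hl : ∀ l : corner (K := K) e, toCorner he.idem (l : Codual K A) = l := fun l =>
      Subtype.ext (Codual.ext fun a => l.2 a)
    have hπ : ∀ (l : corner (K := K) e) a, (π l : Codual K A) a = (l : Codual K A) (x * a) := by
      intro l a
      have h1 : (π l : Codual K A) a = (π (a • l) : Codual K A) 1 := by
        rw [map_smul, Submodule.coe_smul, smul_apply, one_mul]
      rw [h1, ← hl (a • l)]
      exact hx' _
    have hππ : ∀ l, π (π l) = π l := fun l => by simp [π]
    have h1 : e * x * e = e * x := sep _ _ fun μ => by
      have h2 := (π (toCorner he.idem μ)).2 1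
      rw [hπ, hπ, toCorner_apply, toCorner_apply] at h2
      simpa only [mul_one, mul_assoc] using h2
    have h3 : e * x * x = e * x := sep _ _ fun μ => by
      have h2 := DFunLike.congr_fun (congrArg Subtype.val (hππ (toCorner he.idem μ))) (1 : A)
      rw [hπ, hπ, hπ, toCorner_apply, toCorner_apply] at h2
      simpa only [mul_one, mul_assoc] using h2
    have hπ' : ∀ (l : corner (K := K) e) a,
        (π l : Codual K A) a = (l : Codual K A) ((e * x) * a) := fun l a => by
      rw [hπ, mul_assoc, l.2]
    rcases he.eq_zero_or_eq (e * x) (by rw [← mul_assoc, h1, h3])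
      (by rw [← mul_assoc, he.idem]) h1 with h4 | h4
    · left
      rw [Submodule.eq_bot_iff]
      intro l hlN
      have h5 : π l = l := by
        simpa [π] using hlN
      rw [← h5]
      refine Subtype.ext (Codual.ext fun a => ?_)
      rw [hπ', h4, zero_mul, map_zero]; rfl
    · right
      rw [Submodule.eq_bot_iff]
      intro l hlN
      have h5 : π l = 0 := by
        simp [π, hlN]
      rw [← h5]
      refine Subtype.ext (Codual.ext fun a => ?_)
      rw [hπ', h4, l.2]

theorem isUniserialModule_corner [FiniteDimensional K A] (hA : IsNakayama A) {e : A}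
    (he : IsPrimitiveIdempotent e) : IsUniserialModule A (corner (K := K) e) := by
  refine hA.injective_uniserial _ ?_ (injective_corner he.idem) (isIndecomposableModule_corner he)
  have : Module.Finite K (corner (K := K) e) :=
    inferInstanceAs (Module.Finite K ((corner (K := K) e).restrictScalars K))
  exact Module.Finite.of_restrictScalars_finite K A _

end Codual

end Codual

/-! ### Right uniseriality and uniserial injective hulls by duality -/

section RightUniserial

/-- The dual D(eA) must lie in the universe of A for the Nakayama hypothesis to apply to it. The
field embeds in the nonzero ring A, so it may be replaced by a copy in that universe. -/
theorem exists_finiteDimensional_algebra_small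
    (K : Type u) [Field K] (A : Type v) [Ring A] [Algebra K A] [FiniteDimensional K A]
    [Nontrivial A] :
    ∃ (F : Type v) (_ : Field F) (_ : Algebra F A), FiniteDimensional F A := by
  have : Small.{v} K := small_of_injective (algebraMap K A).injective
  let ρ : Shrink.{v} K ≃+* K := Shrink.ringEquiv K
  let _ : Algebra (Shrink.{v} K) A := ((algebraMap K A).comp (ρ : Shrink.{v} K →+* K)).toAlgebra'
    fun c x => Algebra.commutes (ρ c) x
  refine ⟨Shrink.{v} K, inferInstance, inferInstance, ?_⟩
  obtain ⟨s, hs⟩ := Module.finite_def.1 (inferInstance : FiniteDimensional K A)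
  refine Module.finite_def.2 ⟨s, ?_⟩
  rw [eq_top_iff]
  intro x _
  have hx : x ∈ Submodule.span K (s : Set A) := hs ▸ Submodule.mem_top
  induction hx using Submodule.span_induction with
  | mem x hx => exact Submodule.subset_span hx
  | zero => exact zero_mem _
  | add x y _ _ hx hy => exact add_mem (hx trivial) (hy trivial)
  | smul k x _ hx =>
    have : k • x = ρ.symm k • x := by
      rw [Algebra.smul_def, Algebra.smul_def]
      change _ = algebraMap K A (ρ (ρ.symm k)) * x
      rw [ρ.apply_symm_apply]
    rw [this]
    exact Submodule.smul_mem _ _ (hx trivial)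

variable (K : Type u) [Field K] {A : Type v} [Ring A] [Algebra K A] [FiniteDimensional K A]

include K in
-- The right ideals aA and bA in eA are comparable because their annihilators in the uniserial
-- module D(eA) are; a separating functional reverses the inclusion.
theorem IsPrimitiveIdempotent.exists_mul_eq_or (hA : IsNakayama A) {e a b : A}
    (he : IsPrimitiveIdempotent e) (ha : e * a = a) (hb : e * b = b) :
    (∃ c, b = a * c) ∨ ∃ c, a = b * c := by
  have : Nontrivial A := ⟨e, 0, he.ne_zero⟩
  obtain ⟨F, _, _, _⟩ := exists_finiteDimensional_algebra_small K A
  let ann : A → Submodule A (Codual.corner (K := F) e) := fun a =>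
    { carrier := {l | ∀ c, (l : Codual F A) (a * c) = 0}
      add_mem' := fun {l m} hl hm c => by
        rw [Submodule.coe_add, Codual.add_apply, hl, hm, add_zero]
      zero_mem' := fun c => rfl
      smul_mem' := fun b l hl c => by
        rw [Submodule.coe_smul, Codual.smul_apply, mul_assoc, hl] }
  have key : ∀ a b : A, e * a = a → e * b = b → ann a ≤ ann b → ∃ c, b = a * c := by
    intro a b ha hb h
    by_contra! hcon
    have hmem : b ∉ LinearMap.range (LinearMap.mulLeft F a) := by
      rintro ⟨c, hc⟩
      exact hcon c hc.symm
    obtain ⟨μ, hμ, hμ'⟩ := Submodule.exists_le_ker_of_notMem hmem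
    have h1 : Codual.toCorner he.idem μ ∈ ann a := fun c => by
      rw [Codual.toCorner_apply, ← mul_assoc, ha]
      exact hμ' ⟨c, rfl⟩
    have h2 := h h1 1
    rw [Codual.toCorner_apply, mul_one, hb] at h2
    exact hμ h2
  exact (Codual.isUniserialModule_corner (K := F) hA he (ann a) (ann b)).imp (key a b ha hb)
    (key b a hb ha)

include K in
-- Choose a primitive g not killing a generator z of the socle, and a functional μ with μ(gz) ≠ 0.
-- The map U → D(gA) defined by μ is nonzero at z, and every nonzero submodule of U contains z.
theorem exists_injective_uniserial (hA : IsNakayama A) {U : Type v} [AddCommGroup U] [Module A U]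
    [Nontrivial U] [IsArtinian A U] (hU : IsUniserialModule A U) :
    ∃ (E : Type v) (_ : AddCommGroup E) (_ : Module A E), Module.Injective A E ∧
      IsUniserialModule A E ∧ ∃ i : U →ₗ[A] E, Function.Injective i := by
  have : Nontrivial A := Module.nontrivial A U
  have : IsArtinianRing A := IsArtinianRing.of_finite K A
  obtain ⟨F, _, _, _⟩ := exists_finiteDimensional_algebra_small K A
  let _ : Module F U := Module.compHom U (algebraMap F A)
  have _ : IsScalarTower F A U := IsScalarTower.of_algebraMap_smul fun _ _ => rfl
  obtain ⟨z, hz0, hz⟩ := hU.exists_mem_of_ne_bot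
  obtain ⟨g, hg, hgz⟩ := exists_primitive_smul_ne_zero (A := A) hz0
  obtain ⟨μ, hμ⟩ : ∃ μ : U →ₗ[F] F, μ (g • z) ≠ 0 := by
    by_contra! h
    exact hgz ((Module.forall_dual_apply_eq_zero_iff F _).1 h)
  obtain ⟨φ, hφ⟩ := Codual.exists_linearMap_corner hg.idem μ
  refine ⟨_, _, _, Codual.injective_corner (K := F) hg.idem,
    Codual.isUniserialModule_corner (K := F) hA hg, φ, ?_⟩
  rw [← LinearMap.ker_eq_bot]
  by_contra hker
  have h1 : φ z = 0 := hz _ hker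
  have h2 := hφ z 1
  rw [h1, mul_one] at h2
  exact hμ h2.symm

end RightUniserial

/-! ### Relative injectivity and direct summands over Nakayama algebras -/

section RelativeInjective

variable {A : Type v} [Ring A]

/-- The `n`-th power of the Jacobson radical annihilates `M`. -/
def JacobsonPowKills (A : Type v) [Ring A] (n : ℕ) (M : Type*) [AddCommGroup M] [Module A M] :
    Prop :=
  ∀ a ∈ Ring.jacobson A ^ n, ∀ m : M, a • m = 0

theorem JacobsonPowKills.of_injective {n : ℕ} {M N : Type*} [AddCommGroup M] [Module A M]
    [AddCommGroup N] [Module A N] (h : JacobsonPowKills A n N) (φ : M →ₗ[A] N)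
    (hφ : Function.Injective φ) : JacobsonPowKills A n M := fun a ha m =>
  hφ (by rw [map_smul, h a ha, map_zero])

theorem JacobsonPowKills.of_surjective {n : ℕ} {M N : Type*} [AddCommGroup M] [Module A M]
    [AddCommGroup N] [Module A N] (h : JacobsonPowKills A n M) (φ : M →ₗ[A] N)
    (hφ : Function.Surjective φ) : JacobsonPowKills A n N := fun a ha m => by
  obtain ⟨m, rfl⟩ := hφ m
  rw [← map_smul, h a ha, map_zero]

theorem JacobsonPowKills.eq_zero {M : Type*} [AddCommGroup M] [Module A M]
    (h : JacobsonPowKills A 0 M) (m : M) : m = 0 := by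
  have := h 1 (by rw [Submodule.pow_zero]; exact Submodule.one_le.1 le_rfl) m
  rwa [one_smul] at this

theorem exists_jacobsonPowKills [IsArtinianRing A] :
    ∃ n : ℕ, ∀ (M : Type v) [AddCommGroup M] [Module A M], JacobsonPowKills A n M := by
  obtain ⟨n, hn⟩ := IsSemiprimaryRing.isNilpotent (R := A)
  refine ⟨n, fun M _ _ a ha m => ?_⟩
  rw [hn] at ha
  rw [(Submodule.mem_bot A).1 ha, zero_smul]

/-- `U` is injective relative to finitely generated modules killed by the `n`-th power of the
Jacobson radical. -/
def IsRelInjective (A : Type v) [Ring A] (n : ℕ) (U : Type*) [AddCommGroup U] [Module A U] :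
    Prop :=
  ∀ (Z : Type v) [AddCommGroup Z] [Module A Z] [Module.Finite A Z], JacobsonPowKills A n Z →
    ∀ (B : Submodule A Z) (φ : B →ₗ[A] U), ∃ ψ : Z →ₗ[A] U, ∀ b : B, ψ b = φ b

namespace IsRelInjective

theorem of_equiv {n : ℕ} {U V : Type*} [AddCommGroup U] [Module A U] [AddCommGroup V] [Module A V]
    (h : IsRelInjective A n U) (e : U ≃ₗ[A] V) : IsRelInjective A n V := by
  intro Z _ _ _ hZ B φ
  obtain ⟨ψ, hψ⟩ := h Z hZ B (e.symm.toLinearMap ∘ₗ φ)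
  exact ⟨e.toLinearMap ∘ₗ ψ, fun b => by simp [hψ]⟩

theorem prod {n : ℕ} {U V : Type*} [AddCommGroup U] [Module A U] [AddCommGroup V] [Module A V]
    (hU : IsRelInjective A n U) (hV : IsRelInjective A n V) : IsRelInjective A n (U × V) := by
  intro Z _ _ _ hZ B φ
  obtain ⟨ψ, hψ⟩ := hU Z hZ B (LinearMap.fst A U V ∘ₗ φ)
  obtain ⟨χ, hχ⟩ := hV Z hZ B (LinearMap.snd A U V ∘ₗ φ)
  exact ⟨ψ.prod χ, fun b => Prod.ext (hψ b) (hχ b)⟩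

variable {M : Type v} [AddCommGroup M] [Module A M]

theorem bot {n : ℕ} : IsRelInjective A n (⊥ : Submodule A M) :=
  fun _ _ _ _ _ _ _ => ⟨0, fun _ => Subsingleton.elim _ _⟩

theorem sup {n : ℕ} {E U : Submodule A M} (hE : IsRelInjective A n E) (hU : IsRelInjective A n U)
    (hd : Disjoint E U) : IsRelInjective A n (E ⊔ U : Submodule A M) := by
  let θ : E × U →ₗ[A] (E ⊔ U : Submodule A M) :=
    (Submodule.inclusion le_sup_left).coprod (Submodule.inclusion le_sup_right)
  have hθ : ∀ x, (θ x : M) = x.1 + x.2 := fun x => rfl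
  refine (hE.prod hU).of_equiv (LinearEquiv.ofBijective θ ⟨?_, ?_⟩)
  · rw [← LinearMap.ker_eq_bot, LinearMap.ker_eq_bot']
    rintro ⟨x, y⟩ h
    have h1 : (x : M) + y = 0 := (hθ _).symm.trans (congrArg Subtype.val h)
    have h2 : (x : M) = -y := eq_neg_of_add_eq_zero_left h1
    have h3 : (x : M) = 0 := Submodule.disjoint_def.1 hd _ x.2 (h2 ▸ neg_mem y.2)
    have h4 : (y : M) = 0 := by rwa [h3, zero_add] at h1
    exact Prod.ext (Subtype.ext h3) (Subtype.ext h4)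
  · rintro ⟨z, hz⟩
    obtain ⟨x, hx, y, hy, rfl⟩ := Submodule.mem_sup.1 hz
    exact ⟨(⟨x, hx⟩, ⟨y, hy⟩), rfl⟩

/-- The source B is finitely generated, so its image already lies in one member of the chain. This
is why relative injectivity is tested on finitely generated modules only. -/
theorem sSup [IsNoetherianRing A] {n : ℕ} {c : Set (Submodule A M)} (hc : IsChain (· ≤ ·) c)
    (hne : c.Nonempty) (h : ∀ E ∈ c, IsRelInjective A n E) :
    IsRelInjective A n (sSup c : Submodule A M) := by
  intro Z _ _ _ hZ B φ
  have hfg : (LinearMap.range ((SupSet.sSup c : Submodule A M).subtype ∘ₗ φ)).FG := by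
    rw [LinearMap.range_eq_map]
    exact (Module.Finite.fg_top (R := A) (M := B)).map _
  obtain ⟨E, hE, hle⟩ := (CompleteLattice.isCompactElement_iff_le_of_directed_sSup_le _ _).1
    ((Submodule.fg_iff_compact _).1 hfg) c hne hc.directedOn (by
      rintro _ ⟨b, rfl⟩; exact (φ b).2)
  obtain ⟨ψ, hψ⟩ := h E hE Z hZ B
    (((SupSet.sSup c : Submodule A M).subtype ∘ₗ φ).codRestrict E fun b => hle ⟨b, rfl⟩)
  refine ⟨Submodule.inclusion (le_sSup hE) ∘ₗ ψ, fun b => Subtype.ext ?_⟩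
  exact congrArg (Subtype.val : E → M) (hψ b)

/-- A relatively injective submodule has a complement containing any given disjoint submodule. -/
theorem exists_isCompl {n : ℕ} (hM : JacobsonPowKills A n M) {E F : Submodule A M}
    (hE : IsRelInjective A n E) (hEF : Disjoint E F) :
    ∃ L : Submodule A M, F ≤ L ∧ IsCompl E L := by
  obtain ⟨L, hFL, hL, hmax⟩ := zorn_le_nonempty₀ {L : Submodule A M | Disjoint E L}
    (fun c hc hch y hy => ⟨_, (hch.directedOn).disjoint_sSup_right.2 fun L hL => hc hL,
      fun z hz => le_sSup hz⟩) F hEF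
  refine ⟨L, hFL, hL, codisjoint_iff.2 (eq_top_iff.2 fun z _ => ?_)⟩
  let i : E →ₗ[A] M ⧸ L := L.mkQ ∘ₗ E.subtype
  have hi : Function.Injective i := by
    rw [← LinearMap.ker_eq_bot, LinearMap.ker_eq_bot']
    intro x hx
    exact Subtype.ext (Submodule.disjoint_def.1 hL _ x.2 ((Submodule.Quotient.mk_eq_zero L).1 hx))
  let j := LinearEquiv.ofInjective i hi
  let Z := Submodule.span A {L.mkQ z}
  let z' : Z := ⟨L.mkQ z, Submodule.mem_span_singleton_self _⟩
  obtain ⟨ψ, hψ⟩ := hE Z ((hM.of_surjective L.mkQ L.mkQ_surjective).of_injective Z.subtype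
    Z.injective_subtype) ((LinearMap.range i).comap Z.subtype)
    (j.symm.toLinearMap ∘ₗ (Z.subtype.restrict fun _ h => h))
  have hψ' : ∀ (y : Z) (x : E), (y : M ⧸ L) = i x → ψ y = x := fun y x hyx => by
    rw [hψ ⟨y, ⟨x, hyx.symm⟩⟩]
    change j.symm _ = x
    rw [LinearEquiv.symm_apply_eq]
    exact Subtype.ext hyx
  -- Since ψ is a retraction on Az ∩ E modulo L, the correction z - ψ(z) spans a submodule meeting E
  -- trivially. Maximality of L then puts z - ψ(z) in L.
  let D := Submodule.span A {L.mkQ z - i (ψ z')}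
  have hD : Disjoint E (D.comap L.mkQ) := by
    rw [Submodule.disjoint_def]
    intro x hxE hxD
    obtain ⟨a, ha⟩ := Submodule.mem_span_singleton.1 hxD
    have h1 : ((a • z' : Z) : M ⧸ L) = i (⟨x, hxE⟩ + a • ψ z') := by
      rw [map_add, map_smul]
      change a • L.mkQ z = L.mkQ x + _
      rw [← ha, smul_sub, sub_add_cancel]
    have h2 := hψ' _ _ h1
    rw [map_smul, right_eq_add] at h2
    exact congrArg Subtype.val h2
  have hLD : L ≤ D.comap L.mkQ := fun x hx => by
    rw [Submodule.mem_comap, Submodule.mkQ_apply, (Submodule.Quotient.mk_eq_zero L).2 hx]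
    exact zero_mem _
  have h3 : z - (ψ z' : M) ∈ L := hmax hD hLD (by
    rw [Submodule.mem_comap, map_sub]
    exact Submodule.mem_span_singleton_self _)
  rw [← add_sub_cancel (ψ z' : M) z]
  exact Submodule.add_mem_sup (ψ z').2 h3

end IsRelInjective

variable (K : Type u) [Field K] [Algebra K A] [FiniteDimensional K A]

include K in
-- Embed Ax in a uniserial injective E and extend φ to h : Z → E. If h left Ax, uniseriality would
-- give x = jgh(w) with j in the radical J, so ax would lie in Jⁿ⁺¹h(w) = 0.
theorem IsPrimitiveIdempotent.isRelInjective_span (hA : IsNakayama A) {e : A}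
    (he : IsPrimitiveIdempotent e) {M : Type v} [AddCommGroup M] [Module A M] {x : M}
    (hx : e • x = x) {n : ℕ} {a : A} (ha : a ∈ Ring.jacobson A ^ n) (hax : a • x ≠ 0) :
    IsRelInjective A (n + 1) (Submodule.span A {x}) := by
  intro Z _ _ _ hZ B φ
  have : IsArtinianRing A := IsArtinianRing.of_finite K A
  let x' : Submodule.span A {x} := ⟨x, Submodule.mem_span_singleton_self x⟩
  have hax' : a • x' ≠ 0 := fun h => hax (congrArg Subtype.val h)
  have : Nontrivial (Submodule.span A {x}) := ⟨_, _, hax'⟩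
  have : Module.Finite A (Submodule.span A {x}) := Module.Finite.span_singleton A x
  obtain ⟨E, _, _, hE, hEu, i, hi⟩ := exists_injective_uniserial K hA
    (he.isUniserialModule_span_singleton hA hx)
  obtain ⟨h, hh⟩ := hE.out B.subtype B.injective_subtype (i ∘ₗ φ)
  have hrange : ∀ w : Z, h w ∈ LinearMap.range i := by
    intro w
    by_contra hw
    obtain ⟨g, hg, hgw⟩ := exists_primitive_smul_notMem (A := A)
      (N := (LinearMap.range i).toAddSubmonoid) hw
    rcases hEu (LinearMap.range i) (Submodule.span A {g • h w}) with h1 | h1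
    · rcases hg.mem_jacobson_smul_or_mem_span hA (x := g • h w) (u := i x')
        (by rw [smul_smul, hg.idem]) (h1 ⟨x', rfl⟩) with ⟨j, hj, hjx⟩ | h2
      · apply hax'
        apply hi
        rw [map_smul, hjx, map_zero, smul_smul, ← map_smul, ← map_smul,
          hZ (a * j) (by rw [Submodule.pow_succ]; exact Ideal.mul_mem_mul ha hj), map_zero]
      · exact hgw ((Submodule.span_singleton_le_iff_mem (i x') (LinearMap.range i)).2 ⟨x', rfl⟩ h2)
    · exact hgw (h1 (Submodule.mem_span_singleton_self _))
  refine ⟨(LinearEquiv.ofInjective i hi).symm.toLinearMap ∘ₗ h.codRestrict _ hrange, fun b => ?_⟩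
  change (LinearEquiv.ofInjective i hi).symm _ = _
  rw [LinearEquiv.symm_apply_eq]
  exact Subtype.ext (hh b)

include K in
theorem exists_isRelInjective_span (hA : IsNakayama A) {M : Type v} [AddCommGroup M] [Module A M]
    {n : ℕ} (hn : ¬ JacobsonPowKills A n M) :
    ∃ (e : A) (x : M), IsPrimitiveIdempotent e ∧ e • x = x ∧ x ≠ 0 ∧
      IsRelInjective A (n + 1) (Submodule.span A {x}) := by
  have : IsArtinianRing A := IsArtinianRing.of_finite K A
  obtain ⟨a, ha, m, ham⟩ : ∃ a ∈ Ring.jacobson A ^ n, ∃ m : M, a • m ≠ 0 := by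
    simpa [JacobsonPowKills] using hn
  obtain ⟨e, he, hem⟩ := exists_primitive_smul_notMem (A := A)
    (N := AddMonoidHom.mker (DistribSMul.toAddMonoidHom M a)) (x := m) ham
  have hem' : a • e • m ≠ 0 := hem
  have hx : e • e • m = e • m := by rw [smul_smul, he.idem]
  exact ⟨e, e • m, he, hx, fun h => hem' (by rw [h, smul_zero]),
    he.isRelInjective_span K hA hx ha hem'⟩

include K in
/-- Indecomposable modules over a Nakayama algebra are cyclic, generated by an element fixed by a
primitive idempotent. -/
theorem IsIndecomposableModule.exists_generator (hA : IsNakayama A) {M : Type v} [AddCommGroup M]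
    [Module A M] (hM : IsIndecomposableModule A M) :
    ∃ (e : A) (x : M), IsPrimitiveIdempotent e ∧ e • x = x ∧ Submodule.span A {x} = ⊤ := by
  classical
  have : IsArtinianRing A := IsArtinianRing.of_finite K A
  have hex : ∃ n, JacobsonPowKills A n M := exists_jacobsonPowKills.imp fun n h => h M
  have hk := Nat.find_spec hex
  -- With n + 1 the least exponent killing M, some x has Jⁿx ≠ 0, so Ax is injective relative to
  -- modules killed by Jⁿ⁺¹ and splits off.
  obtain ⟨n, hn⟩ : ∃ n, Nat.find hex = n + 1 := Nat.exists_eq_succ_of_ne_zero fun h0 => by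
    rw [h0] at hk
    obtain ⟨x, hx⟩ := @exists_ne M hM.1 0
    exact hx (hk.eq_zero x)
  rw [hn] at hk
  obtain ⟨e, x, he, hx, hx0, hinj⟩ := exists_isRelInjective_span K hA
    (Nat.find_min hex (show n < Nat.find hex by omega))
  obtain ⟨L, -, hL⟩ := hinj.exists_isCompl hk disjoint_bot_right
  refine ⟨e, x, he, hx, ?_⟩
  rcases hM.2 _ _ hL with h | h
  · exact absurd (Submodule.span_singleton_eq_bot.1 h) hx0
  · simpa [h] using hL.sup_eq_top

include K in
-- Induction on the radical length: split off a relatively injective E so large that its complement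
-- L is killed by Jⁿ. As E need not be finitely generated, a finitely generated part U of E is
-- chosen first, large enough that the rest F' of F can be kept inside L.
theorem exists_fg_retract_of_kills (hA : IsNakayama A) (n : ℕ) (M : Type v) [AddCommGroup M]
    [Module A M] (hM : JacobsonPowKills A n M) (F : Submodule A M) (hF : F.FG) :
    ∃ N : Submodule A M, N.FG ∧ F ≤ N ∧
      ∃ r : M →ₗ[A] M, (∀ m, r m ∈ N) ∧ ∀ m ∈ N, r m = m := by
  have : IsNoetherianRing A := IsNoetherianRing.of_finite K A
  induction n generalizing M with
  | zero =>
    have h0 : ∀ m : M, m = 0 := hM.eq_zero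
    exact ⟨⊥, Submodule.fg_bot, fun m _ => (Submodule.mem_bot A).2 (h0 m), 0,
      fun m => zero_mem _, fun m _ => (h0 m).symm⟩
  | succ n ih =>
    have : IsNoetherian A F := isNoetherian_of_fg_of_noetherian F hF
    -- U is chosen with U ∩ F maximal, which is possible because F is noetherian.
    obtain ⟨D, ⟨U, hUfg, hU, rfl⟩, hmax⟩ := set_has_maximal_iff_noetherian.2 this
      {D : Submodule A F | ∃ U : Submodule A M, U.FG ∧ IsRelInjective A (n + 1) U ∧
        D = U.comap F.subtype} ⟨_, ⊥, Submodule.fg_bot, IsRelInjective.bot, rfl⟩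
    obtain ⟨C, -, hC⟩ := hU.exists_isCompl hM disjoint_bot_right
    have hF' : U ⊔ (F ⊔ U) ⊓ C = F ⊔ U := by
      rw [inf_comm, ← sup_inf_assoc_of_le C (le_sup_right : U ≤ F ⊔ U), hC.sup_eq_top, top_inf_eq]
    have hUF' : Disjoint U ((F ⊔ U) ⊓ C) := hC.disjoint.mono_right inf_le_right
    have hF'fg : ((F ⊔ U) ⊓ C).FG := by
      have : IsNoetherian A (F ⊔ U : Submodule A M) :=
        isNoetherian_of_fg_of_noetherian _ (hF.sup hUfg)
      exact Submodule.FG.of_le (hF.sup hUfg) inf_le_left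
    generalize (F ⊔ U) ⊓ C = F' at hF' hUF' hF'fg
    obtain ⟨E, hUE, ⟨hE, hEF'⟩, hEmax⟩ := zorn_le_nonempty₀
      {E : Submodule A M | IsRelInjective A (n + 1) E ∧ Disjoint E F'}
      (fun c hc hch y hy => ⟨sSup c, ⟨IsRelInjective.sSup hch ⟨y, hy⟩ fun E hE => (hc hE).1,
        hch.directedOn.disjoint_sSup_left.2 fun E hE => (hc hE).2⟩,
        fun z hz => le_sSup hz⟩) U ⟨hU, hUF'⟩
    obtain ⟨L, hF'L, hL⟩ := hE.exists_isCompl hM hEF'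
    -- Otherwise L contains a relatively injective V = Ax ≠ 0. By maximality of E, the sum E + V
    -- meets F' nontrivially, in fact in an element of V. Then U + V meets F in more than U does,
    -- against the choice of U.
    have hkill : JacobsonPowKills A n L := by
      by_contra hkill
      obtain ⟨e, x, he, hx, hx0, hinj⟩ := exists_isRelInjective_span K hA hkill
      let V := (Submodule.span A {x}).map L.subtype
      have hV : IsRelInjective A (n + 1) V :=
        hinj.of_equiv (Submodule.equivMapOfInjective L.subtype L.injective_subtype _)
      have hVfg : V.FG := (Submodule.fg_span_singleton x).map _
      have hVL : V ≤ L := Submodule.map_subtype_le _ _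
      have hxV : (x : M) ∈ V := ⟨x, Submodule.mem_span_singleton_self x, rfl⟩
      have hEV : Disjoint E V := hL.disjoint.mono_right hVL
      have hnd : ¬ Disjoint (E ⊔ V) F' := fun hd => by
        have h1 := hEmax ⟨hE.sup hV hEV, hd⟩ le_sup_left
        exact hx0 (Subtype.ext (Submodule.disjoint_def.1 hEV _ (h1 (le_sup_right (a := E) hxV)) hxV))
      obtain ⟨f', hf', hf'F, hf'0⟩ : ∃ f' ∈ E ⊔ V, f' ∈ F' ∧ f' ≠ 0 := by
        by_contra! hcon
        exact hnd (Submodule.disjoint_def.2 hcon)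
      obtain ⟨y, hy, w, hw, rfl⟩ := Submodule.mem_sup.1 hf'
      have hy0 : y = 0 := Submodule.disjoint_def.1 hL.disjoint y hy (by
        simpa using sub_mem (hF'L hf'F) (hVL hw))
      rw [hy0, zero_add] at hf'F hf'0
      obtain ⟨f, hf, u, hu, hfu⟩ := Submodule.mem_sup.1
        (hF' ▸ (le_sup_right (a := U) hf'F) : w ∈ F ⊔ U)
      refine hmax _ ⟨U ⊔ V, hUfg.sup hVfg, hU.sup hV (hEV.mono_left hUE), rfl⟩
        (lt_of_le_of_ne (Submodule.comap_mono le_sup_left) fun heq => hf'0 ?_)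
      have hfUV : f ∈ U ⊔ V := by
        rw [eq_sub_of_add_eq hfu]
        exact sub_mem (le_sup_right (a := U) hw) (le_sup_left (b := V) hu)
      have hfU : (⟨f, hf⟩ : F) ∈ U.comap F.subtype := heq ▸ hfUV
      exact Submodule.disjoint_def.1 hUF' w (hfu ▸ add_mem hfU hu) hf'F
    obtain ⟨N, hNfg, hN, r, hr, hr'⟩ := ih L hkill (F'.comap L.subtype) (by
      refine Submodule.fg_of_fg_map_injective L.subtype L.injective_subtype ?_
      rwa [Submodule.map_comap_eq_of_le (by simpa using hF'L)])
    let p : M →ₗ[A] M := L.subtype ∘ₗ r ∘ₗ Submodule.projectionOnto L E hL.symm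
    let q : M →ₗ[A] M := U.subtype ∘ₗ Submodule.projectionOnto U C hC
    have hpN : ∀ m, p m ∈ N.map L.subtype := fun m => ⟨_, hr _, rfl⟩
    have hpid : ∀ m ∈ N.map L.subtype, p m = m := by
      rintro _ ⟨m, hm, rfl⟩
      simp [p, hr' m hm]
    have hpU : ∀ m ∈ U, p m = 0 := fun m hm => by
      simp [p, (Submodule.projectionOnto_apply_eq_zero_iff hL.symm).2 (hUE hm)]
    have hqU : ∀ m, q m ∈ U := fun m => (Submodule.projectionOnto U C hC m).2
    have hqid : ∀ m ∈ U, q m = m := fun m hm => by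
      simpa [q] using congrArg Subtype.val (Submodule.projectionOnto_apply_left hC ⟨m, hm⟩)
    -- The projections p and q need not be orthogonal: p kills U, but q need not kill N. Hence the
    -- correction p + q(1 - p).
    refine ⟨U ⊔ N.map L.subtype, hUfg.sup (hNfg.map _), ?_, p + q ∘ₗ (LinearMap.id - p), ?_, ?_⟩
    · refine (le_sup_left.trans hF'.ge).trans (sup_le_sup_left ?_ U)
      intro m hm
      exact ⟨⟨m, hF'L hm⟩, hN hm, rfl⟩
    · intro m
      exact add_mem (le_sup_right (a := U) (hpN m)) (le_sup_left (a := U) (hqU _))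
    · intro m hm
      obtain ⟨x, hx, y, hy, rfl⟩ := Submodule.mem_sup.1 hm
      have h1 : p (x + y) = y := by rw [map_add, hpU x hx, hpid y hy, zero_add]
      simp only [LinearMap.add_apply, LinearMap.comp_apply, LinearMap.sub_apply,
        LinearMap.id_apply, h1, add_sub_cancel_right, hqid x hx]
      abel

include K in
/-- Over a Nakayama algebra, every finitely generated submodule of an arbitrary module lies in a
finitely generated direct summand. -/
theorem exists_fg_retract (hA : IsNakayama A) {M : Type v} [AddCommGroup M] [Module A M]
    {F : Submodule A M} (hF : F.FG) : ∃ N : Submodule A M, N.FG ∧ F ≤ N ∧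
      ∃ r : M →ₗ[A] N, r ∘ₗ N.subtype = LinearMap.id := by
  have : IsArtinianRing A := IsArtinianRing.of_finite K A
  obtain ⟨n, hn⟩ := exists_jacobsonPowKills (A := A)
  obtain ⟨N, hN, hFN, r, hr, hr'⟩ := exists_fg_retract_of_kills K hA n M (hn M) F hF
  refine ⟨N, hN, hFN, r.codRestrict N hr, ?_⟩
  ext x
  exact hr' x x.2

end RelativeInjective

/-! ### Simple objects among the local modules -/

section SimpleLocal

variable {A : Type v} [Ring A] {S : Set (FGProjectiveMap A)}

/-- A nonzero `S`-local module without nontrivial `S`-local submodules. -/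
structure IsSimpleLocal (S : Set (FGProjectiveMap A)) (X : Type*) [AddCommGroup X] [Module A X] :
    Prop where
  nontrivial : Nontrivial X
  isLocal : IsLocal S X
  eq_bot_or_eq_top : ∀ N : Submodule A X, IsLocal S N → N = ⊥ ∨ N = ⊤

namespace IsSimpleLocal

variable {X Y : Type*} [AddCommGroup X] [Module A X] [AddCommGroup Y] [Module A Y]

theorem of_equiv (h : IsSimpleLocal S X) (e : X ≃ₗ[A] Y) : IsSimpleLocal S Y where
  nontrivial := haveI := h.nontrivial; e.injective.nontrivial
  isLocal := h.isLocal.of_equiv e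
  eq_bot_or_eq_top N hN := by
    have h1 : IsLocal S (N.map e.symm.toLinearMap) := hN.of_equiv
      (Submodule.equivMapOfInjective e.symm.toLinearMap e.symm.injective N)
    refine (h.eq_bot_or_eq_top _ h1).imp (fun h2 => ?_) (fun h2 => ?_)
    · exact Submodule.map_injective_of_injective e.symm.injective (h2.trans (Submodule.map_bot _).symm)
    · rw [eq_top_iff]
      intro y _
      obtain ⟨n, hn, hny⟩ := (h2 ▸ Submodule.mem_top : e.symm y ∈ N.map e.symm.toLinearMap)
      rwa [← e.symm.injective hny]

/-- Schur's lemma: the kernel and the range are local submodules. -/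
theorem bijective_of_ne_zero (hX : IsSimpleLocal S X) (hY : IsSimpleLocal S Y) {φ : X →ₗ[A] Y}
    (hφ : φ ≠ 0) : Function.Bijective φ := by
  constructor
  · rw [← LinearMap.ker_eq_bot]
    exact (hX.eq_bot_or_eq_top _ (hX.isLocal.ker hY.isLocal φ)).resolve_right fun h =>
      hφ (LinearMap.ker_eq_top.1 h)
  · rw [← LinearMap.range_eq_top]
    exact (hY.eq_bot_or_eq_top _ (hX.isLocal.range hY.isLocal φ)).resolve_left fun h =>
      hφ (LinearMap.range_eq_bot.1 h)

theorem isIndecomposableModule (hX : IsSimpleLocal S X) : IsIndecomposableModule A X :=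
  ⟨hX.nontrivial, fun N N' h => (hX.eq_bot_or_eq_top N (hX.isLocal.of_isCompl h)).imp_right
    fun h1 => by simpa [h1] using h.inf_eq_bot⟩

end IsSimpleLocal

theorem IsLocal.exists_isSimpleLocal_submodule {M : Type*} [AddCommGroup M] [Module A M]
    [IsArtinian A M] [Nontrivial M] (hM : IsLocal S M) : ∃ N : Submodule A M, IsSimpleLocal S N := by
  obtain ⟨N, ⟨hN0, hN⟩, hmin⟩ := IsArtinian.set_has_minimal
    {N : Submodule A M | N ≠ ⊥ ∧ IsLocal S N} ⟨⊤, top_ne_bot, hM.of_equiv Submodule.topEquiv.symm⟩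
  refine ⟨N, Submodule.nontrivial_iff_ne_bot.2 hN0, hN, fun L hL => ?_⟩
  by_contra! hcon
  refine hmin (L.map N.subtype) ⟨fun h => hcon.1 ?_, hL.of_equiv
    (Submodule.equivMapOfInjective N.subtype N.injective_subtype L)⟩
    (lt_of_le_of_ne (Submodule.map_subtype_le _ _) fun h => hcon.2 ?_)
  · exact Submodule.map_injective_of_injective N.injective_subtype
      (h.trans (Submodule.map_bot _).symm)
  · rw [eq_top_iff]
    intro x _
    obtain ⟨y, hy, hyx⟩ := h.ge x.2
    rwa [← Subtype.ext hyx]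

theorem IsLocal.of_ker {M N : Type*} [AddCommGroup M] [Module A M] [AddCommGroup N] [Module A N]
    {φ : M →ₗ[A] N} (hφ : Function.Surjective φ) (hk : IsLocal S (LinearMap.ker φ))
    (hN : IsLocal S N) : IsLocal S M :=
  hk.of_extension (hN.of_equiv (φ.quotKerEquivOfSurjective hφ).symm)

/-- The finitely generated local modules are determined by the simple objects among them. -/
theorem IsLocal.of_forall_isSimpleLocal [IsArtinianRing A] {S' : Set (FGProjectiveMap A)}
    (h : ∀ (X : Type v) [AddCommGroup X] [Module A X], Module.Finite A X → IsSimpleLocal S X →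
      IsLocal S' X)
    {M : Type v} [AddCommGroup M] [Module A M] [Module.Finite A M] (hM : IsLocal S M) :
    IsLocal S' M := by
  have hbot : ∀ T : Set (FGProjectiveMap A), IsLocal T (⊥ : Submodule A M) := fun T σ _ =>
    ⟨fun φ ψ _ => LinearMap.ext fun x => Subsingleton.elim _ _,
      fun θ => ⟨0, LinearMap.ext fun x => Subsingleton.elim _ _⟩⟩
  -- N is a largest submodule local for both sets. If N ≠ M, the preimage of a simple local
  -- submodule of M/N is an extension local for both sets, and it is strictly larger.
  obtain ⟨N, ⟨hN, hN'⟩, hmax⟩ := set_has_maximal_iff_noetherian.2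
    (inferInstance : IsNoetherian A M)
    {N : Submodule A M | IsLocal S N ∧ IsLocal S' N} ⟨⊥, hbot S, hbot S'⟩
  by_cases hNtop : N = ⊤
  · subst hNtop
    exact hN'.of_equiv Submodule.topEquiv
  exfalso
  have : Nontrivial (M ⧸ N) := Submodule.Quotient.nontrivial_iff.2 hNtop
  obtain ⟨X, hX⟩ := (hN.quotient hM).exists_isSimpleLocal_submodule
  let φ : X.comap N.mkQ →ₗ[A] X := N.mkQ.restrict fun _ h => h
  have hφ : Function.Surjective φ := by
    rintro ⟨x, hx⟩
    obtain ⟨m, rfl⟩ := N.mkQ_surjective x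
    exact ⟨⟨m, hx⟩, rfl⟩
  have hle : N ≤ X.comap N.mkQ := fun x hx => by
    rw [Submodule.mem_comap, Submodule.mkQ_apply, (Submodule.Quotient.mk_eq_zero N).2 hx]
    exact zero_mem _
  have hmemker : ∀ y : X.comap N.mkQ, y ∈ LinearMap.ker φ ↔ (y : M) ∈ N := fun y => by
    rw [LinearMap.mem_ker, ← Submodule.Quotient.mk_eq_zero N]
    exact ⟨fun h => congrArg Subtype.val h, fun h => Subtype.ext h⟩
  let e : N ≃ₗ[A] LinearMap.ker φ := LinearEquiv.ofBijective
    ((Submodule.inclusion hle).codRestrict _ fun x => (hmemker _).2 x.2)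
    ⟨fun x y hxy => Subtype.ext (congrArg (fun z : LinearMap.ker φ => ((z : X.comap N.mkQ) : M)) hxy),
      fun y => ⟨⟨((y : X.comap N.mkQ) : M), (hmemker _).1 y.2⟩, rfl⟩⟩
  have hX' : IsLocal S' X := h X inferInstance hX
  refine hmax (X.comap N.mkQ) ⟨.of_ker hφ (hN.of_equiv e) hX.isLocal,
    .of_ker hφ (hN'.of_equiv e) hX'⟩ (lt_of_le_of_ne hle fun heq => ?_)
  have := hX.nontrivial
  obtain ⟨x, hx⟩ := exists_ne (0 : X)
  obtain ⟨y, rfl⟩ := hφ x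
  exact hx ((hmemker y).2 (heq.ge y.2))

end SimpleLocal

/-! ### Cyclic modules and generators fixed by idempotents -/

section Generators

variable {A : Type v} [Ring A]

/-- A map out of a cyclic module is determined by annihilators. -/
theorem exists_linearMap_of_span_eq_top {M N : Type*} [AddCommGroup M] [Module A M]
    [AddCommGroup N] [Module A N] {x : M} {y : N} (hx : Submodule.span A {x} = ⊤)
    (h : ∀ a : A, a • x = 0 → a • y = 0) : ∃ φ : M →ₗ[A] N, φ x = y := by
  obtain ⟨φ, hφ⟩ := exists_linearMap_span_singleton h
  refine ⟨φ ∘ₗ LinearMap.codRestrict _ LinearMap.id fun m => by rw [hx]; trivial, ?_⟩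
  rw [LinearMap.comp_apply, hφ 1 _ (one_smul A x).symm, one_smul]

theorem span_eq_top_of_mem {M : Type*} [AddCommGroup M] [Module A M] {x y : M}
    (hx : Submodule.span A {x} = ⊤) (h : x ∈ Submodule.span A {y}) :
    Submodule.span A {y} = ⊤ := by
  rw [eq_top_iff, ← hx]
  exact (Submodule.span_singleton_le_iff_mem _ _).2 h

theorem IsPrimitiveIdempotent.exists_generator_of_decomposition (hA : IsNakayama A) {e : A}
    (he : IsPrimitiveIdempotent e) {s : Finset A} (hs : ∀ g ∈ s, IsPrimitiveIdempotent g)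
    (h1 : (1 : A) ∈ AddSubmonoid.closure (s : Set A)) {M : Type*} [AddCommGroup M] [Module A M]
    {x : M} (hx : e • x = x) (hx0 : x ≠ 0) (htop : Submodule.span A {x} = ⊤) :
    ∃ g ∈ s, ∃ y : M, g • y = y ∧ Submodule.span A {y} = ⊤ := by
  let N : Submodule A M := Submodule.map (LinearMap.toSpanSingleton A M x) (Ring.jacobson A)
  have hN : x ∉ N := by
    rintro ⟨j, hj, hjx⟩
    rw [SetLike.mem_coe, ← Ideal.jacobson_bot, Ideal.mem_jacobson_iff] at hj
    -- Nakayama's lemma for Ax: z is a left inverse of 1 - j, so x = jx would force x = 0.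
    obtain ⟨z, hz⟩ := hj (-1)
    have hz' : z - z * j = 1 := by
      have := (Submodule.mem_bot A).1 hz
      rw [mul_neg_one, neg_mul] at this
      rw [← sub_eq_zero, ← this]; abel
    apply hx0
    rw [← one_smul A x, ← hz', sub_smul, mul_smul]
    change z • x - z • LinearMap.toSpanSingleton A M x j = 0
    rw [hjx, sub_self]
  obtain ⟨g, hg, hgx⟩ : ∃ g ∈ s, g • x ∉ N := by
    by_contra! hcon
    exact hN (mem_of_forall_smul_mem (N := N.toAddSubmonoid) h1 hcon)
  refine ⟨g, hg, g • x, by rw [smul_smul, (hs g hg).idem], ?_⟩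
  rcases he.mem_jacobson_smul_or_mem_span hA hx
    (Submodule.mem_span_singleton.2 ⟨g, rfl⟩ : g • x ∈ Submodule.span A {x}) with ⟨j, hj, h⟩ | h
  · exact absurd ⟨j, hj, h.symm⟩ hgx
  · exact span_eq_top_of_mem htop h

end Generators

/-! ### From local modules to orthogonal collections -/

section ToCollection

variable (K : Type u) [Field K] {A : Type v} [Ring A] [Algebra K A]

/-- The simple objects among the finitely generated `S`-local modules are, up to isomorphism, the
members of `T`. -/
def IsSimpleSystem (S : Set (FGProjectiveMap A)) (T : Set (ModuleCat.{v} A)) : Prop :=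
  ∀ (X : Type v) [AddCommGroup X] [Module A X], Module.Finite A X →
    (IsSimpleLocal S X ↔ ∃ Y ∈ T, Nonempty (X ≃ₗ[A] Y))

/-- By Schur's lemma the endomorphism algebra is a finite dimensional domain over K, hence K itself.
-/
theorem IsSimpleLocal.hasTrivialEndomorphisms [IsAlgClosed K] [FiniteDimensional K A]
    {S : Set (FGProjectiveMap A)} {X : Type v} [AddCommGroup X] [Module A X] [Module.Finite A X]
    (hX : IsSimpleLocal S X) : HasTrivialEndomorphisms K A X := by
  let _ : Module K X := Module.compHom X (algebraMap K A)
  have _ : IsScalarTower K A X := IsScalarTower.of_algebraMap_smul fun _ _ => rfl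
  have : Module.Finite K X := Module.Finite.trans A X
  have : Module.Finite K (Module.End A X) := Module.Finite.of_injective
    (LinearMap.restrictScalarsₗ K A X X K) (LinearMap.restrictScalars_injective K)
  have := hX.nontrivial
  have : NoZeroDivisors (Module.End A X) := ⟨fun {φ ψ} h => by
    by_contra! hcon
    have h1 := ((hX.bijective_of_ne_zero hX hcon.1).comp (hX.bijective_of_ne_zero hX hcon.2)).1
    obtain ⟨x, hx⟩ := exists_ne (0 : X)
    refine hx (h1 ?_)
    rw [← Module.End.coe_mul, h]
    simp⟩
  have : IsDomain (Module.End A X) := NoZeroDivisors.to_isDomain _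
  exact ⟨(AlgEquiv.ofBijective (Algebra.ofId K (Module.End A X))
    (IsAlgClosed.algebraMap_bijective_of_isIntegral (k := K) (K := Module.End A X))).symm⟩

theorem exists_orthogonalCollection [IsAlgClosed K] [FiniteDimensional K A] (hA : IsNakayama A)
    (S : Set (FGProjectiveMap A)) :
    ∃ T : OrthogonalCollection K A, IsSimpleSystem S T.carrier := by
  have : IsArtinianRing A := IsArtinianRing.of_finite K A
  let iso : Setoid (ModuleCat.{v} A) :=
    { r := fun X Y => Nonempty (X ≃ₗ[A] Y)
      iseqv := ⟨fun X => ⟨LinearEquiv.refl A X⟩, fun ⟨e⟩ => ⟨e.symm⟩,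
        fun ⟨e⟩ ⟨d⟩ => ⟨e.trans d⟩⟩ }
  -- T takes one representative from each isomorphism class, so that isomorphic members are equal.
  let rep : ModuleCat.{v} A → ModuleCat.{v} A := fun X => (Quotient.mk iso X).out
  have hrep : ∀ X, Nonempty (rep X ≃ₗ[A] X) := fun X => Quotient.mk_out (s := iso) X
  have hrep_eq : ∀ X Y : ModuleCat.{v} A, Nonempty (X ≃ₗ[A] Y) → rep X = rep Y := fun X Y h =>
    congrArg Quotient.out (Quotient.sound (s := iso) h)
  let T : Set (ModuleCat.{v} A) := {X | Module.Finite A X ∧ IsSimpleLocal S X ∧ rep X = X}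
  have hT : ∀ X ∈ T, ∀ Y ∈ T, ∀ φ : X →ₗ[A] Y, φ ≠ 0 → X = Y := fun X hX Y hY φ hφ => by
    rw [← hX.2.2, ← hY.2.2]
    exact hrep_eq X Y ⟨LinearEquiv.ofBijective φ (hX.2.1.bijective_of_ne_zero hY.2.1 hφ)⟩
  obtain ⟨s, hs, h1⟩ := exists_primitive_decomposition (1 : A) (mul_one 1)
  have hgen : ∀ X : T, ∃ g : s, ∃ y : (X : ModuleCat.{v} A), (g : A) • y = y ∧
      Submodule.span A {y} = ⊤ := fun X => by
    have := X.2.2.1.nontrivial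
    obtain ⟨e, x, he, hx, htop⟩ := X.2.2.1.isIndecomposableModule.exists_generator K hA
    have hx0 : x ≠ 0 := by
      rintro rfl
      rw [Submodule.span_zero_singleton] at htop
      exact bot_ne_top htop
    obtain ⟨g, hg, y, hy⟩ := he.exists_generator_of_decomposition hA hs h1 hx hx0 htop
    exact ⟨⟨g, hg⟩, y, hy⟩
  choose g y hgy hytop using hgen
  have hy0 : ∀ X : T, y X ≠ 0 := fun X h0 => by
    have := X.2.2.1.nontrivial
    have h2 := hytop X
    rw [h0, Submodule.span_zero_singleton] at h2
    exact bot_ne_top h2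
  have hinj : Function.Injective g := fun X Y hXY => Subtype.ext (by
    have hgY := hgy Y
    rw [← hXY] at hgY
    rcases (hs _ (g X).2).annihilator_le_or_le hA (hgy X) hgY with h | h
    · obtain ⟨φ, hφ⟩ := exists_linearMap_of_span_eq_top (hytop X) h
      exact hT X X.2 Y Y.2 φ fun h0 => hy0 Y (by rw [← hφ, h0, LinearMap.zero_apply])
    · obtain ⟨φ, hφ⟩ := exists_linearMap_of_span_eq_top (hytop Y) h
      exact (hT Y Y.2 X X.2 φ fun h0 => hy0 X (by rw [← hφ, h0, LinearMap.zero_apply])).symm)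
  refine ⟨{ carrier := T
            finite := Set.finite_coe_iff.1 (Finite.of_injective g hinj)
            finitelyGenerated := fun X hX => hX.1
            indecomposable := fun X hX => hX.2.1.isIndecomposableModule
            trivialEndomorphisms := fun X hX =>
              haveI := hX.1
              hX.2.1.hasTrivialEndomorphisms K
            orthogonal := fun X hX Y hY hne φ => by
              by_contra hφ
              exact hne (hT X hX Y hY φ hφ) }, fun X _ _ hX => ⟨fun h => ?_, ?_⟩⟩
  · obtain ⟨e⟩ := hrep (ModuleCat.of A X)
    have : Module.Finite A (ModuleCat.of A X) := hX
    refine ⟨rep (ModuleCat.of A X), ⟨Module.Finite.equiv e.symm,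
      IsSimpleLocal.of_equiv (X := X) h e.symm, hrep_eq _ _ ⟨e⟩⟩, ⟨e.symm⟩⟩
  · rintro ⟨Y, hY, ⟨e⟩⟩
    exact hY.2.1.of_equiv e.symm

end ToCollection

/-! ### From orthogonal collections to local modules -/

section OfCollection

variable {K : Type u} [Field K] {A : Type v} [Ring A] [Algebra K A]

theorem HasTrivialEndomorphisms.bijective_of_ne_zero {X : Type v} [AddCommGroup X] [Module A X]
    (hX : HasTrivialEndomorphisms K A X) {φ : X →ₗ[A] X} (hφ : φ ≠ 0) : Function.Bijective φ := by
  let _ : Module K X := Module.compHom X (algebraMap K A)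
  have _ : IsScalarTower K A X := IsScalarTower.of_algebraMap_smul fun _ _ => rfl
  obtain ⟨ε⟩ : Nonempty (Module.End A X ≃ₐ[K] K) := hX
  have h0 : ε φ ≠ 0 := fun h => hφ (ε.injective (h.trans (map_zero ε).symm))
  have hu : IsUnit (ε φ) := h0.isUnit
  have hu' : IsUnit (φ : Module.End A X) := by simpa using hu.map ε.symm
  exact (Module.End.isUnit_iff φ).1 hu'

namespace OrthogonalCollection

variable (T : OrthogonalCollection K A)

theorem bijective_of_ne_zero {X Y : ModuleCat.{v} A} (hX : X ∈ T.carrier) (hY : Y ∈ T.carrier)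
    {φ : X →ₗ[A] Y} (hφ : φ ≠ 0) : Function.Bijective φ := by
  by_cases h : X = Y
  · subst h
    exact (T.trivialEndomorphisms X hX).bijective_of_ne_zero hφ
  · exact absurd (T.orthogonal X hX Y hY h φ) hφ

/-- The maps between projective modules generated by idempotents with respect to which all members
of the collection are local. -/
def idempotentMaps : Set (IdempotentMap A) := {τ | ∀ X ∈ T.carrier, τ.ActsBijectively X}

variable {T} [FiniteDimensional K A] (hA : IsNakayama A)
include hA

/-- An element `a` of `e A f` lies in `T.idempotentMaps` if `a • w` is nonzero for a generator `w` of
a member `X` of the collection, and every submodule of `X` that has a member of the collection as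
a quotient in which `a • w` survives is mapped isomorphically. -/
theorem mem_idempotentMaps {τ : IdempotentMap A} (he : IsPrimitiveIdempotent τ.src)
    (hf : IsPrimitiveIdempotent τ.tgt) {X : ModuleCat.{v} A} (hX : X ∈ T.carrier) {w : X}
    (hw : τ.tgt • w = w) (hwtop : Submodule.span A {w} = ⊤) (haw : τ.elt • w ≠ 0)
    (H : ∀ X' ∈ T.carrier, ∀ (N : Submodule A X) (hN : τ.elt • w ∈ N) (ψ : N →ₗ[A] X'),
      Function.Surjective ψ → ψ ⟨τ.elt • w, hN⟩ ≠ 0 → Function.Injective ψ) :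
    τ ∈ T.idempotentMaps := by
  intro X' hX'
  refine ⟨fun m hm ham => ?_, fun x' hx' => ?_⟩
  -- If m ≠ 0 and ann w ⊆ ann m, then w ↦ m defines an isomorphism X → X', and aw ≠ 0 contradicts am
  -- = 0. The opposite inclusion contradicts aw ≠ 0 at once.
  · rcases hf.annihilator_le_or_le hA hw hm with h | h
    · by_contra hm0
      obtain ⟨φ, hφ⟩ := exists_linearMap_of_span_eq_top hwtop h
      have hφ0 : φ ≠ 0 := fun h0 => hm0 (by rw [← hφ, h0, LinearMap.zero_apply])
      exact haw ((T.bijective_of_ne_zero hX hX' hφ0).1 (by rw [map_smul, hφ, ham, map_zero]))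
    · exact absurd (h _ ham) haw
  · by_cases hx0 : x' = 0
    · exact ⟨0, smul_zero _, by rw [smul_zero, hx0]⟩
    obtain ⟨f', y', hf', hy', hytop'⟩ := (T.indecomposable X' hX').exists_generator K hA
    obtain ⟨a₀, ha₀⟩ := Submodule.mem_span_singleton.1 (hytop' ▸ Submodule.mem_top : x' ∈ _)
    obtain ⟨a', hea', haf', hax'⟩ : ∃ a', τ.src * a' = a' ∧ a' * f' = a' ∧ a' • y' = x' :=
      ⟨τ.src * a₀ * f', by rw [← mul_assoc, ← mul_assoc, he.idem], by rw [mul_assoc, hf'.idem],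
        by rw [mul_smul, hy', mul_smul, ha₀, hx']⟩
    -- Right uniseriality of eA. If a' = ac, then x' = a'y' is visibly in the image of a. If a =
    -- a'c, a preimage of x' is found by transporting w along an isomorphism X' → X.
    rcases he.exists_mul_eq_or K hA τ.src_mul hea' with ⟨c, hc⟩ | ⟨c, hc⟩
    · refine ⟨(τ.tgt * c) • y', by rw [smul_smul, ← mul_assoc, hf.idem], ?_⟩
      rw [smul_smul, ← mul_assoc, τ.mul_tgt, ← hc, hax']
    · obtain ⟨y, hy, hay⟩ : ∃ y : X, f' • y = y ∧ a' • y = τ.elt • w :=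
        ⟨(f' * c) • w, by rw [smul_smul, ← mul_assoc, hf'.idem], by
          rw [smul_smul, ← mul_assoc, haf', ← hc]⟩
      -- If instead ann y ⊆ ann y', then y ↦ y' maps Ay onto X' and aw to x' ≠ 0. By `H` this map is
      -- injective, so the annihilators are equal.
      have hann : ∀ b : A, b • y' = 0 → b • y = 0 := by
        rcases hf'.annihilator_le_or_le hA hy' hy with h | h
        · exact h
        · obtain ⟨ψ, hψ⟩ := exists_linearMap_span_singleton h
          have hmem : τ.elt • w ∈ Submodule.span A {y} :=
            Submodule.mem_span_singleton.2 ⟨a', hay⟩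
          have hψi := H X' hX' _ hmem ψ (fun z => by
            obtain ⟨b, hb⟩ := Submodule.mem_span_singleton.1 (hytop' ▸ Submodule.mem_top : z ∈ _)
            exact ⟨⟨b • y, Submodule.mem_span_singleton.2 ⟨b, rfl⟩⟩, by rw [hψ b _ rfl, hb]⟩)
            (by rwa [hψ a' _ hay.symm, hax'])
          intro b hb
          have h1 : (⟨b • y, Submodule.mem_span_singleton.2 ⟨b, rfl⟩⟩ :
              Submodule.span A {y}) = 0 := hψi (by rw [hψ b _ rfl, hb, map_zero])
          exact congrArg Subtype.val h1
      obtain ⟨φ, hφ⟩ := exists_linearMap_of_span_eq_top hytop' hann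
      have hφx : φ x' = τ.elt • w := by rw [← hax', map_smul, hφ, hay]
      have hφb := T.bijective_of_ne_zero hX' hX (φ := φ) fun h0 => haw (by
        rw [← hφx, h0, LinearMap.zero_apply])
      obtain ⟨m, hm⟩ := hφb.2 w
      exact ⟨m, hφb.1 (by rw [map_smul, hm, hw]), hφb.1 (by rw [map_smul, hm, hφx])⟩

omit hA in
/-- Elements of `e X` have the form `a • w` with `a ∈ e A f` for a generator `w = f w`. -/
theorem exists_idempotentMap {e f : A} (he : e * e = e) (hf : f * f = f) {X : Type*}
    [AddCommGroup X] [Module A X] {w x : X} (hw : f • w = w) (hwtop : Submodule.span A {w} = ⊤)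
    (hx : e • x = x) : ∃ τ : IdempotentMap A, τ.src = e ∧ τ.tgt = f ∧ τ.elt • w = x := by
  obtain ⟨a, ha⟩ := Submodule.mem_span_singleton.1 (hwtop ▸ Submodule.mem_top : x ∈ _)
  exact ⟨⟨e, f, e * a * f, he, hf, by rw [← mul_assoc, ← mul_assoc, he],
    by rw [mul_assoc, hf]⟩, rfl, rfl, by rw [mul_smul, hw, mul_smul, ha, hx]⟩

/-- Take a with aw = ez, where z generates the socle of X and w generates X. A map that does not
kill ez is injective, so the criterion applies to a. A nonzero local submodule contains ez, hence a
preimage of ez under a; by uniqueness this preimage is w. -/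
theorem isSimpleLocal {X : ModuleCat.{v} A} (hX : X ∈ T.carrier) :
    IsSimpleLocal (IdempotentMap.toFGProjectiveMap '' T.idempotentMaps) X := by
  have : IsArtinianRing A := IsArtinianRing.of_finite K A
  have := T.finitelyGenerated X hX
  have := (T.indecomposable X hX).1
  refine ⟨this, isLocal_image_iff.2 fun τ hτ => hτ X hX, fun N hN => ?_⟩
  obtain ⟨f, w, hf, hw, hwtop⟩ := (T.indecomposable X hX).exists_generator K hA
  have hu : IsUniserialModule A X := by
    have h1 := hf.isUniserialModule_span_singleton hA hw
    rw [hwtop] at h1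
    exact h1.of_surjective Submodule.topEquiv.toLinearMap Submodule.topEquiv.surjective
  obtain ⟨z, hz0, hz⟩ := hu.exists_mem_of_ne_bot
  obtain ⟨e, he, hez⟩ := exists_primitive_smul_ne_zero (A := A) hz0
  obtain ⟨τ, rfl, rfl, hτ⟩ := exists_idempotentMap he.idem hf.idem hw hwtop
    (x := e • z) (by rw [smul_smul, he.idem])
  have hτT : τ ∈ T.idempotentMaps := by
    refine mem_idempotentMaps hA he hf hX hw hwtop (hτ ▸ hez) fun X' _ L hL ψ _ hψ => ?_
    rw [← LinearMap.ker_eq_bot]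
    by_contra hker
    have h1 : z ∈ (LinearMap.ker ψ).map L.subtype := hz _ fun h => hker
      (Submodule.map_injective_of_injective L.injective_subtype
        (h.trans (Submodule.map_bot _).symm))
    obtain ⟨l, hl, hlz⟩ := h1
    have h2 : (⟨τ.elt • w, hL⟩ : L) = τ.src • l := Subtype.ext
      (hτ.trans (congrArg (τ.src • ·) hlz).symm)
    rw [h2, map_smul, LinearMap.mem_ker.1 hl, smul_zero] at hψ
    exact hψ rfl
  by_cases hN0 : N = ⊥
  · exact Or.inl hN0
  right
  have hzN : τ.src • z ∈ N := N.smul_mem _ (hz N hN0)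
  obtain ⟨m, hm, hm'⟩ := (isLocal_image_iff.1 hN τ hτT).exists_eq ⟨τ.src • z, hzN⟩
    (Subtype.ext (by change τ.src • τ.src • z = _; rw [smul_smul, he.idem]))
  have hmw : (m : X) = w := by
    rw [← sub_eq_zero]
    refine (hτT X hX).eq_zero _ ?_ ?_
    · rw [smul_sub, hw]
      exact congrArg (· - w) (congrArg Subtype.val hm)
    · rw [smul_sub, hτ, sub_eq_zero]
      exact congrArg Subtype.val hm'
  rw [eq_top_iff, ← hwtop]
  exact (Submodule.span_singleton_le_iff_mem _ _).2 (hmw ▸ m.2)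

/-- Choose X shortest among the members with eX ≠ 0. A submodule N of X mapping onto a member X'
with eX' ≠ 0 satisfies length N ≤ length X ≤ length X', so the map is injective and the criterion
applies to any a with 0 ≠ aw ∈ eX. -/
theorem exists_minimal_idempotentMap {e : A} (he : IsPrimitiveIdempotent e)
    (h : ∃ X ∈ T.carrier, ∃ x : X, e • x = x ∧ x ≠ 0) :
    ∃ X ∈ T.carrier, ∃ w : X, ∃ τ ∈ T.idempotentMaps, τ.src = e ∧ IsPrimitiveIdempotent τ.tgt ∧
      τ.tgt • w = w ∧ Submodule.span A {w} = ⊤ ∧ w ≠ 0 := by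
  have : IsArtinianRing A := IsArtinianRing.of_finite K A
  obtain ⟨X, ⟨hX, x, hx, hx0⟩, hmin⟩ := (InvImage.wf (fun X : ModuleCat.{v} A => Module.length A X)
    wellFounded_lt).has_min {X | X ∈ T.carrier ∧ ∃ x : X, e • x = x ∧ x ≠ 0} h
  have := T.finitelyGenerated X hX
  obtain ⟨f, w, hf, hw, hwtop⟩ := (T.indecomposable X hX).exists_generator K hA
  obtain ⟨τ, rfl, rfl, hτ⟩ := exists_idempotentMap he.idem hf.idem hw hwtop hx
  refine ⟨X, hX, w, τ, ?_, rfl, hf, hw, hwtop, fun h0 => hx0 (by rw [← hτ, h0, smul_zero])⟩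
  refine mem_idempotentMaps hA he hf hX hw hwtop (hτ ▸ hx0) fun X' hX' N hN ψ hψ hψ0 => ?_
  have hle : Module.length A X ≤ Module.length A X' := not_lt.1 (hmin X' ⟨hX', _, by
    rw [← map_smul]
    congr 1
    exact Subtype.ext (by change τ.src • τ.elt • w = τ.elt • w; rw [smul_smul, τ.src_mul]), hψ0⟩)
  have hadd := Module.length_eq_add_of_exact (LinearMap.ker ψ).subtype ψ
    (LinearMap.ker ψ).injective_subtype hψ (LinearMap.exact_subtype_ker_map ψ)
  have hNX : Module.length A N ≤ Module.length A X :=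
    Module.length_le_of_injective N.subtype N.injective_subtype
  have hfin : Module.length A N ≠ ⊤ := Module.length_ne_top
  have h0 : Module.length A (LinearMap.ker ψ) = 0 := by
    have hfin' : Module.length A X' ≠ ⊤ := ne_top_of_le_ne_top hfin (hadd ▸ le_add_self)
    have h1 : Module.length A (LinearMap.ker ψ) + Module.length A X' ≤ 0 + Module.length A X' := by
      rw [← hadd, zero_add]; exact hNX.trans hle
    exact le_antisymm ((ENat.add_le_add_iff_right hfin').1 h1) zero_le
  rw [← LinearMap.ker_eq_bot, ← Submodule.subsingleton_iff_eq_bot]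
  exact Module.length_eq_zero_iff.1 h0

/-- Let Y be simple local with generator y = ey. If eX ≠ 0 for some member, the minimal map pulls y
back to a generator m = fm of Y. Comparing annihilators with the generator w = fw of a member gives
a nonzero map between two simple local modules, an isomorphism. -/
theorem isSimpleSystem :
    IsSimpleSystem (IdempotentMap.toFGProjectiveMap '' T.idempotentMaps) T.carrier := by
  refine fun Y _ _ hY => ⟨fun hYs => ?_, fun ⟨X, hX, ⟨ε⟩⟩ =>
    (isSimpleLocal hA hX).of_equiv ε.symm⟩
  obtain ⟨e, y, he, hy, hytop⟩ := hYs.isIndecomposableModule.exists_generator K hA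
  have := hYs.nontrivial
  have hy0 : y ≠ 0 := by
    rintro rfl
    rw [Submodule.span_zero_singleton] at hytop
    exact bot_ne_top hytop
  have hYl := isLocal_image_iff.1 hYs.isLocal
  by_cases h : ∃ X ∈ T.carrier, ∃ x : X, e • x = x ∧ x ≠ 0
  · obtain ⟨X, hX, w, τ, hτ, rfl, hf, hw, hwtop, hw0⟩ := exists_minimal_idempotentMap hA he h
    obtain ⟨m, hm, hm'⟩ := (hYl τ hτ).exists_eq y hy
    have hmtop : Submodule.span A {m} = ⊤ := span_eq_top_of_mem hytop
      (Submodule.mem_span_singleton.2 ⟨_, hm'⟩)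
    have hXs := isSimpleLocal hA hX
    rcases hf.annihilator_le_or_le hA hm hw with h1 | h1
    · obtain ⟨φ, hφ⟩ := exists_linearMap_of_span_eq_top hmtop h1
      exact ⟨X, hX, ⟨LinearEquiv.ofBijective φ (hYs.bijective_of_ne_zero hXs fun h0 =>
        hw0 (by rw [← hφ, h0, LinearMap.zero_apply]))⟩⟩
    · obtain ⟨φ, hφ⟩ := exists_linearMap_of_span_eq_top hwtop h1
      exact ⟨X, hX, ⟨(LinearEquiv.ofBijective φ (hXs.bijective_of_ne_zero hYs fun h0 => hy0 (by
        rw [← hm', ← hφ, h0, LinearMap.zero_apply, smul_zero]))).symm⟩⟩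
  · push Not at h
    -- If e kills every member, the map Ae → 0 is among those inverted, so eY = 0, contradicting y ≠
    -- 0.
    let τ : IdempotentMap A := ⟨e, 0, 0, he.idem, mul_zero 0, mul_zero e, mul_zero 0⟩
    have hτ : τ ∈ T.idempotentMaps := fun X hX =>
      ⟨fun m hm _ => by rw [← hm]; exact zero_smul A m,
        fun x hx => ⟨0, smul_zero _, by rw [smul_zero, h X hX x hx]⟩⟩
    obtain ⟨m, -, hm⟩ := (hYl τ hτ).exists_eq y hy
    exact absurd (hm.symm.trans (zero_smul A m)) hy0

end OrthogonalCollection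

end OfCollection

/-! ### The bijection -/

section Main

variable (K : Type u) [Field K] {A : Type v} [Ring A] [Algebra K A] [FiniteDimensional K A]

include K in
-- The range of a map from a finitely generated projective lies in a finitely generated summand of
-- M, which is S-local as a retract of M. Existence and uniqueness of extensions are checked there.
theorem IsLocal.of_forall_finite (hA : IsNakayama A) {S S' : Set (FGProjectiveMap A)}
    (h : ∀ (X : Type v) [AddCommGroup X] [Module A X], Module.Finite A X → IsLocal S X →
      IsLocal S' X) {M : Type v} [AddCommGroup M] [Module A M] (hM : IsLocal S M) :
    IsLocal S' M := by
  intro σ hσ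
  have := σ.source_finite
  have := σ.target_finite
  refine ⟨fun φ ψ e => ?_, fun θ => ?_⟩
  · obtain ⟨N, hN, hle, r, hr⟩ := exists_fg_retract K hA (F := LinearMap.range (φ - ψ)) (by
      rw [LinearMap.range_eq_map]; exact Module.Finite.fg_top.map _)
    have hNl := h N (Module.Finite.iff_fg.2 hN) (hM.of_retract N.subtype r hr) σ hσ
    have h0 : (φ - ψ).codRestrict N (fun x => hle ⟨x, rfl⟩) = 0 := hNl.eq_zero (by
      ext x
      have h1 := LinearMap.congr_fun e x
      exact sub_eq_zero.2 h1)
    rw [← sub_eq_zero]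
    ext x
    exact congrArg Subtype.val (LinearMap.congr_fun h0 x)
  · obtain ⟨N, hN, hle, r, hr⟩ := exists_fg_retract K hA (F := LinearMap.range θ) (by
      rw [LinearMap.range_eq_map]; exact Module.Finite.fg_top.map _)
    have hNl := h N (Module.Finite.iff_fg.2 hN) (hM.of_retract N.subtype r hr) σ hσ
    obtain ⟨ψ, hψ⟩ := hNl.exists_extension (θ.codRestrict N fun x => hle ⟨x, rfl⟩)
    refine ⟨N.subtype ∘ₗ ψ, LinearMap.ext fun x => ?_⟩
    exact congrArg Subtype.val (LinearMap.congr_fun hψ x)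

include K in
theorem InvertsMaps.of_forall_finite (hA : IsNakayama A) {S S' : Set (FGProjectiveMap A)}
    (h : ∀ (X : Type v) [AddCommGroup X] [Module A X], Module.Finite A X → IsLocal S X →
      IsLocal S' X) {C : Type v} [Ring C] {f : A →+* C} (hf : InvertsMaps S f) :
    InvertsMaps S' f := by
  let _ : Module A C := Module.compHom C f
  exact .of_isLocal (fun _ _ => rfl) (.of_forall_finite K hA h (hf.isLocal fun _ _ => rfl))

theorem IsUniversalLocalisationAt.exists_ringEquiv {S S' : Set (FGProjectiveMap A)}
    (hSS' : ∀ {C : Type v} [Ring C] {g : A →+* C}, InvertsMaps S g ↔ InvertsMaps S' g)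
    {B B' : Type v} [Ring B] [Ring B'] {f : A →+* B} {f' : A →+* B'}
    (hf : IsUniversalLocalisationAt S f) (hf' : IsUniversalLocalisationAt S' f') :
    ∃ h : B ≃+* B', (h : B →+* B').comp f = f' := by
  obtain ⟨h, hh, -⟩ := hf.2 B' f' (hSS'.2 hf'.1)
  obtain ⟨h', hh', -⟩ := hf'.2 B f (hSS'.1 hf.1)
  have h1 : h'.comp h = RingHom.id B := (hf.2 B f hf.1).unique
    (by rw [RingHom.comp_assoc, hh, hh']) (RingHom.id_comp f)
  have h2 : h.comp h' = RingHom.id B' := (hf'.2 B' f' hf'.1).unique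
    (by rw [RingHom.comp_assoc, hh', hh]) (RingHom.id_comp f')
  exact ⟨RingEquiv.ofRingHom h h' h2 h1, hh⟩

include K in
/-- A finitely generated local module is a module over the universal localisation, hence local with
respect to all maps inverted by it. -/
theorem IsUniversalLocalisationAt.isLocal_of_ringHom {S S' : Set (FGProjectiveMap A)}
    {B B' : Type v} [Ring B] [Ring B'] {f : A →+* B} {f' : A →+* B'}
    (hf : IsUniversalLocalisationAt S f) (hf' : InvertsMaps S' f') (h : B' →+* B)
    (hh : h.comp f' = f) (X : Type v) [AddCommGroup X] [Module A X] [Module.Finite A X]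
    (hX : IsLocal S X) : IsLocal S' X := by
  let _ : Module K X := Module.compHom X (algebraMap K A)
  have _ : IsScalarTower K A X := IsScalarTower.of_algebraMap_smul fun _ _ => rfl
  have : Module.Finite K X := Module.Finite.trans A X
  let g : A →+* Module.End K X := (Algebra.lsmul K K X : A →ₐ[K] Module.End K X)
  have hg : ∀ a x, g a x = a • x := fun _ _ => rfl
  let _ : Module A (Module.End K X) := Module.compHom _ g
  let b := Module.finBasis K X
  -- Evaluation on a K-basis identifies End_K(X) with a power of X as an A-module, so it is S-local
  -- and A → End_K(X) inverts S.
  let ε : Module.End K X →ₗ[A] (Fin (Module.finrank K X) → X) :=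
    { toFun := fun φ i => φ (b i), map_add' := fun _ _ => rfl, map_smul' := fun _ _ => rfl }
  have hε : Function.Bijective ε := ⟨fun φ ψ e => b.ext fun i => congrFun e i,
    fun y => ⟨b.constr K y, funext fun i => b.constr_basis K y i⟩⟩
  have hgS : InvertsMaps S g := .of_isLocal (fun _ _ => rfl)
    (hX.pi.of_equiv (LinearEquiv.ofBijective ε hε).symm)
  obtain ⟨k, hk, -⟩ := hf.2 _ g hgS
  let _ : Module B' X := Module.compHom X (k.comp h)
  refine hf'.isLocal fun a x => ?_
  change a • x = k (h (f' a)) x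
  rw [show h (f' a) = f a from RingHom.congr_fun hh a, show k (f a) = g a from
    RingHom.congr_fun hk a, hg]

theorem IsSimpleLocal.congr [IsNoetherianRing A] {S S' : Set (FGProjectiveMap A)}
    (h : ∀ (X : Type v) [AddCommGroup X] [Module A X], Module.Finite A X →
      (IsLocal S X ↔ IsLocal S' X)) (X : Type v) [AddCommGroup X] [Module A X]
    [Module.Finite A X] : IsSimpleLocal S X ↔ IsSimpleLocal S' X :=
  ⟨fun hX => ⟨hX.1, (h X inferInstance).1 hX.2, fun N hN =>
      hX.3 N ((h N inferInstance).2 hN)⟩,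
    fun hX => ⟨hX.1, (h X inferInstance).2 hX.2, fun N hN =>
      hX.3 N ((h N inferInstance).1 hN)⟩⟩

variable {K}

omit [FiniteDimensional K A] in
theorem OrthogonalCollection.eq_of_equiv (T : OrthogonalCollection K A) {X Y : ModuleCat.{v} A}
    (hX : X ∈ T.carrier) (hY : Y ∈ T.carrier) (e : X ≃ₗ[A] Y) : X = Y := by
  by_contra h
  obtain ⟨x, hx⟩ := @exists_ne X (T.indecomposable X hX).1 0
  have h0 := LinearMap.congr_fun (T.orthogonal X hX Y hY h e.toLinearMap) x
  exact hx (e.injective (h0.trans (map_zero e).symm))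

omit [FiniteDimensional K A] in
theorem OrthogonalCollection.equiv_of_forall {T T' : OrthogonalCollection K A}
    (h : ∀ X ∈ T.carrier, ∃ Y ∈ T'.carrier, Nonempty (X ≃ₗ[A] Y))
    (h' : ∀ Y ∈ T'.carrier, ∃ X ∈ T.carrier, Nonempty (Y ≃ₗ[A] X)) : T ≈ T' := by
  choose F hF hFe using fun X : T.carrier => h X X.2
  choose G hG hGe using fun Y : T'.carrier => h' Y Y.2
  refine ⟨⟨fun X => ⟨F X, hF X⟩, fun Y => ⟨G Y, hG Y⟩, fun X => Subtype.ext ?_,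
    fun Y => Subtype.ext ?_⟩, hFe⟩
  · exact (T.eq_of_equiv X.2 (hG _) ((hFe X).some.trans (hGe ⟨F X, hF X⟩).some)).symm
  · exact (T'.eq_of_equiv Y.2 (hF _) ((hGe Y).some.trans (hFe ⟨G Y, hG Y⟩).some)).symm

omit [FiniteDimensional K A] in
theorem IsSimpleSystem.exists_equiv {S : Set (FGProjectiveMap A)} {T T' : OrthogonalCollection K A}
    (hT : IsSimpleSystem S T.carrier) (hT' : IsSimpleSystem S T'.carrier) : T ≈ T' :=
  OrthogonalCollection.equiv_of_forall
    (fun X hX => (hT' X (T.finitelyGenerated X hX)).1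
      ((hT X (T.finitelyGenerated X hX)).2 ⟨X, hX, ⟨LinearEquiv.refl A X⟩⟩))
    (fun X hX => (hT X (T'.finitelyGenerated X hX)).1
      ((hT' X (T'.finitelyGenerated X hX)).2 ⟨X, hX, ⟨LinearEquiv.refl A X⟩⟩))

omit [FiniteDimensional K A] in
theorem IsSimpleSystem.of_equiv {S : Set (FGProjectiveMap A)} {T T' : OrthogonalCollection K A}
    (hT : IsSimpleSystem S T.carrier) (h : T ≈ T') : IsSimpleSystem S T'.carrier := by
  obtain ⟨e, he⟩ := h
  refine fun X _ _ hX => (hT X hX).trans ⟨?_, ?_⟩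
  · rintro ⟨Y, hY, ⟨d⟩⟩
    exact ⟨e ⟨Y, hY⟩, (e ⟨Y, hY⟩).2, ⟨d.trans (he ⟨Y, hY⟩).some⟩⟩
  · rintro ⟨Y, hY, ⟨d⟩⟩
    refine ⟨e.symm ⟨Y, hY⟩, (e.symm ⟨Y, hY⟩).2, ?_⟩
    have h1 := he (e.symm ⟨Y, hY⟩)
    rw [e.apply_symm_apply] at h1
    exact ⟨d.trans h1.some.symm⟩

variable (K)

/-- `L` is the universal localisation at a set `S` of maps for which the simple finitely generated
`S`-local modules are the members of `T`. -/
def Corresponds (L : UniversalLocalisation A) (T : OrthogonalCollection K A) : Prop :=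
  ∃ S, IsUniversalLocalisationAt S L.hom ∧ IsSimpleSystem S T.carrier

/-- The localisation determines the finitely generated local modules, hence the simple ones.
Conversely, the simple ones determine the finitely generated local modules by extensions, and these
determine which ring maps invert S; equality of the universal properties gives the isomorphism. -/
theorem Corresponds.equiv_iff (hA : IsNakayama A) {L L' : UniversalLocalisation A}
    {T T' : OrthogonalCollection K A} (h : Corresponds K L T) (h' : Corresponds K L' T') :
    L ≈ L' ↔ T ≈ T' := by
  have : IsArtinianRing A := IsArtinianRing.of_finite K A
  obtain ⟨S, hS, hT⟩ := h
  obtain ⟨S', hS', hT'⟩ := h'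
  constructor
  · rintro ⟨e, he⟩
    have he' : (e.symm : L'.ring →+* L.ring).comp L'.hom = L.hom := by
      rw [← he]; ext; simp
    have hloc : ∀ (X : Type v) [AddCommGroup X] [Module A X], Module.Finite A X →
        (IsLocal S X ↔ IsLocal S' X) := fun X _ _ _ =>
      ⟨hS.isLocal_of_ringHom K hS'.1 _ he' X, hS'.isLocal_of_ringHom K hS.1 _ he X⟩
    refine IsSimpleSystem.exists_equiv (S := S) hT fun X _ _ hX => ?_
    rw [IsSimpleLocal.congr hloc]
    exact hT' X hX
  · intro hTT'
    have hT'' := hT.of_equiv hTT'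
    have h1 : ∀ (X : Type v) [AddCommGroup X] [Module A X], Module.Finite A X → IsLocal S X →
        IsLocal S' X := fun X _ _ _ hX => hX.of_forall_isSimpleLocal fun Y _ _ hY hYs =>
      ((hT' Y hY).2 ((hT'' Y hY).1 hYs)).isLocal
    have h2 : ∀ (X : Type v) [AddCommGroup X] [Module A X], Module.Finite A X → IsLocal S' X →
        IsLocal S X := fun X _ _ _ hX => hX.of_forall_isSimpleLocal fun Y _ _ hY hYs =>
      ((hT'' Y hY).2 ((hT' Y hY).1 hYs)).isLocal
    exact hS.exists_ringEquiv ⟨.of_forall_finite K hA h1, .of_forall_finite K hA h2⟩ hS'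

end Main

theorem theorem5p8 (K : Type u) [Field K] [IsAlgClosed K] (A : Type v) [Ring A] [Algebra K A]
    [FiniteDimensional K A] (hA : IsNakayama A) :
    Nonempty (UniLoc A ≃ OrthogonalCollectionClasses K A) := by
  have hcoll : ∀ L : UniversalLocalisation A, ∃ T : OrthogonalCollection K A,
      Corresponds K L T := fun L => by
    obtain ⟨S, hS⟩ := L.isLocalisation
    exact (exists_orthogonalCollection K hA S).imp fun T hT => ⟨S, hS, hT⟩
  have hloc : ∀ T : OrthogonalCollection K A, ∃ L : UniversalLocalisation A,
      Corresponds K L T := fun T => by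
    obtain ⟨B, _, f, hf⟩ := exists_isUniversalLocalisationAt T.idempotentMaps
    exact ⟨⟨B, f, _, hf⟩, _, hf, T.isSimpleSystem hA⟩
  choose F hF using hcoll
  -- The two directions of `Corresponds.equiv_iff` give well-definedness and injectivity on classes.
  refine ⟨Equiv.ofBijective (Quotient.map F fun L L' h =>
    ((hF L).equiv_iff K hA (hF L')).1 h) ⟨?_, ?_⟩⟩
  · rintro ⟨L⟩ ⟨L'⟩ h
    exact Quotient.sound (((hF L).equiv_iff K hA (hF L')).2 (Quotient.exact h))
  · rintro ⟨T⟩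
    obtain ⟨L, hL⟩ := hloc T
    exact ⟨Quotient.mk _ L, Quotient.sound
      (((hF L).equiv_iff K hA hL).1 (Setoid.refl L))⟩
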